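/- Consider a Markov decision process with finite nonempty state space $\mathcal S$ and action space $\mathcal A$, transition probabilities $p(s'\mid s,a)$ and rewards $\mathcal R(s,a)\in[-1,1]$. For a real vector $x$ let $p_{\mathrm{span}}(x)=(\max_i x_i-\min_i x_i)/2$. Let $\mathcal H$ be the Bellman operator on $\mathbb R^{\mathcal S\times\mathcal A}$, $$[\mathcal H(Q)](s,a)=\mathcal R(s,a)+\sum_{s'}p(s'\mid s,a)\max_{a'}Q(s',a'),$$ and let $r^*$ be the optimal average reward, i.e. the supremum over stationary randomized policies of the long-run average reward $\lim_{K\to\infty}\frac1K\sum_{k=1}^K\mathbb E[\mathcal R(S_k,A_k)\mid S_1=s]$. Assume that 1. $\mathcal H$ is a span-seminorm contraction: there is $\beta\in(0,1)$ with $p_{\mathrm{span}}(\mathcal H(Q_1)-\mathcal H(Q_2))\le\beta\,p_{\mathrm{span}}(Q_1-Q_2)$ for all $Q_1,Q_2$; 2. the behavior policy $\pi$ satisfies $\pi(a\mid s)>0$ for all $(s,a)$, and the Markov chain of states that it induces is irreducible and aperiodic, with stationary distribution $\mu$. Let $D$ be the diagonal matrix with diagonal entries $D(s,a)=\mu(s)\pi(a\mid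 s)$, and let $\bar{\mathcal H}(Q)=(I-D)Q+D\,\mathcal H(Q)$ be the asynchronous Bellman operator. Then the following hold. (a) If $D=I/(|\mathcal S||\mathcal A|)$, then $\{Q: p_{\mathrm{span}}(\bar{\mathcal H}(Q)-Q)=0\}=\{Q: p_{\mathrm{span}}(\mathcal H(Q)-Q)=0\}$. (b) If $D\ne I/(|\mathcal S||\mathcal A|)$ and $r^*\neq0$, then $\{Q: p_{\mathrm{span}}(\bar{\mathcal H}(Q)-Q)=0\}\cap\{Q: p_{\mathrm{span}}(\mathcal H(Q)-Q)=0\}=\emptyset$. (c) There is a $\bar Q^*$ with $p_{\mathrm{span}}(\bar{\mathcal H}(\bar Q^*)-\bar Q^*)=0$ such that, for every sufficiently large $\alpha>0$ and then every sufficiently large $h>0$, $Q$-learning with universal stepsizes $\alpha_k=\alpha/(k+h)$, $$Q_{k+1}(s,a)=Q_k(s,a)+\alpha_k\mathbf 1_{\{(S_k,A_k)=(s,a)\}}\Big(\mathcal R(S_k,A_k)+\max_{a'}Q_k(S_{k+1},a')-Q_k(S_k,A_k)\Big),\qquad k\ge1,$$ run along a trajectory $A_k\sim\pi(\cdot\mid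 S_k)$, $S_{k+1}\sim p(\cdot\mid S_k,A_k)$ from any deterministic $Q_1$ and $S_1$, satisfies $\mathbb E[p_{\mathrm{span}}(Q_k-\bar Q^*)^2]\le\tilde{\mathcal O}(1/k)$. That is, there are an integer $m\ge0$ (not depending on $Q_1,S_1$) and a constant $C$ (not depending on $S_1$ or $k$) such that $$\mathbb E[p_{\mathrm{span}}(Q_k-\bar Q^*)^2]\le C\,\frac{(\log(k+1))^m}{k}\qquad\text{for all }k\ge1.$$ The thresholds for $\alpha$ and $h$ do not depend on $Q_1$ and $S_1$. (d) Consequently the limit is the wrong target: if $D\ne I/(|\mathcal S||\mathcal A|)$ and $r^*\ne0$, then for the iterates in (c) and every $Q$ with $p_{\mathrm{span}}(\mathcal H(Q)-Q)=0$, $\mathbb E[p_{\mathrm{span}}(Q_k-Q)^2]$ does not tend to $0$ as $k\to\infty$. -/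

import Mathlib

open Filter Topology MeasureTheory
open scoped Matrix

noncomputable section

/-- The span seminorm `(max x - min x) / 2` of a real vector. -/
def spanSeminorm {ι : Type*} [Fintype ι] [Nonempty ι] (x : ι → ℝ) : ℝ :=
  (Finset.univ.sup' Finset.univ_nonempty x - Finset.univ.inf' Finset.univ_nonempty x) / 2

/-- A finite undiscounted Markov decision process with rewards in `[-1, 1]`. -/
structure FiniteMDP (S A : Type*) [Fintype S] where
  /-- `trans s a s'` is the probability of moving to `s'` after taking action `a` in state `s`. -/
  trans : S → A → S → ℝ
  trans_mem : ∀ s a, trans s a ∈ stdSimplex ℝ S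
  reward : S → A → ℝ
  reward_mem : ∀ s a, reward s a ∈ Set.Icc (-1 : ℝ) 1

/-- A stationary randomized policy: `prob s a` is the probability of action `a` in state `s`. -/
structure Policy (S A : Type*) [Fintype A] where
  prob : S → A → ℝ
  prob_mem : ∀ s, prob s ∈ stdSimplex ℝ A

namespace FiniteMDP

variable {S A : Type*} [Fintype S] [DecidableEq S] [Nonempty S]
  [Fintype A] [DecidableEq A] [Nonempty A]

/-- `max_a Q(s, a)`. -/
def maxQ (Q : S × A → ℝ) (s : S) : ℝ :=
  Finset.univ.sup' Finset.univ_nonempty fun a : A => Q (s, a)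

/-- The Bellman operator
`[H(Q)](s, a) = R(s, a) + ∑ s', p(s' | s, a) * max_{a'} Q(s', a')`. -/
def bellman (M : FiniteMDP S A) (Q : S × A → ℝ) : S × A → ℝ :=
  fun x => M.reward x.1 x.2 + ∑ s', M.trans x.1 x.2 s' * maxQ Q s'

/-- The Bellman operator is a contraction with respect to the span seminorm. -/
def SpanContraction (M : FiniteMDP S A) : Prop :=
  ∃ β : ℝ, 0 < β ∧ β < 1 ∧ ∀ Q₁ Q₂ : S × A → ℝ,
    spanSeminorm (M.bellman Q₁ - M.bellman Q₂) ≤ β * spanSeminorm (Q₁ - Q₂)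

/-- The transition matrix of the chain of states `S_k` under the policy `π`. -/
def stateMatrix (M : FiniteMDP S A) (π : Policy S A) : Matrix S S ℝ :=
  Matrix.of fun s s' => ∑ a, π.prob s a * M.trans s a s'

/-- `E_π[R(S_k, A_k) | S_1 = s]` for `k ≥ 1`: the chain of states has made `k - 1` steps. -/
def expectedReward (M : FiniteMDP S A) (π : Policy S A) (k : ℕ) (s : S) : ℝ :=
  ∑ s', (M.stateMatrix π ^ (k - 1)) s s' * ∑ a, π.prob s' a * M.reward s' a

/-- `r` is the average reward of the policy `π` started at `s`, i.e.
`r = lim_{K → ∞} (1 / K) ∑_{k = 1}^K E_π[R(S_k, A_k) | S_1 = s]`. -/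
def IsAverageReward (M : FiniteMDP S A) (π : Policy S A) (s : S) (r : ℝ) : Prop :=
  Tendsto (fun K : ℕ => (1 / (K : ℝ)) * ∑ k ∈ Finset.Icc 1 K, M.expectedReward π k s)
    atTop (𝓝 r)

/-- The optimal average reward `r*`: the supremum of the average rewards of all policies. -/
def optimalAverageReward (M : FiniteMDP S A) : ℝ :=
  sSup {r : ℝ | ∃ (π : Policy S A) (s : S), M.IsAverageReward π s r}

/-- Every state has period one: the only common divisor of its return times is `1`. -/
def Aperiodic (P : Matrix S S ℝ) : Prop :=
  ∀ (s : S) (d : ℕ), (∀ n : ℕ, 1 ≤ n → 0 < (P ^ n) s s → d ∣ n) → d = 1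

/-- The assumption on the behavior policy: it gives every action positive probability in every
state, and the chain of states that it induces is irreducible and aperiodic. -/
structure ErgodicPolicy (M : FiniteMDP S A) (π : Policy S A) : Prop where
  prob_pos : ∀ s a, 0 < π.prob s a
  irreducible : (M.stateMatrix π).IsIrreducible
  aperiodic : Aperiodic (M.stateMatrix π)

/-- `μ` is a stationary distribution of the chain of states induced by `π`. -/
def IsStationary (M : FiniteMDP S A) (π : Policy S A) (μ : S → ℝ) : Prop :=
  μ ∈ stdSimplex ℝ S ∧ μ ᵥ* M.stateMatrix π = μ

/-- The diagonal matrix `D` with diagonal entries `μ(s) * π(a | s)`. -/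
def visitMatrix (π : Policy S A) (μ : S → ℝ) : Matrix (S × A) (S × A) ℝ :=
  Matrix.diagonal fun x => μ x.1 * π.prob x.1 x.2

/-- The asynchronous Bellman operator `(I - D) + D H`. -/
def asyncBellman (M : FiniteMDP S A) (π : Policy S A) (μ : S → ℝ) (Q : S × A → ℝ) :
    S × A → ℝ :=
  (1 - visitMatrix π μ) *ᵥ Q + visitMatrix π μ *ᵥ M.bellman Q

/-- `(S_k, A_k)_{k ≥ 1}` is a trajectory of the policy `π` in the MDP started at `S_1 = s₁`:
given the history, `A_k` has law `π(· | S_k)` and `S_{k+1}` has law `p(· | S_k, A_k)`.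
The conditional laws are written as products of probabilities of elementary events
(`s`, `a` range over all sequences of possible values). Index `0` is not used. -/
structure IsTrajectory (M : FiniteMDP S A) (π : Policy S A) (s₁ : S)
    {Ω : Type*} [MeasurableSpace Ω] (ℙ : Measure Ω) (St : ℕ → Ω → S) (Ac : ℕ → Ω → A) :
    Prop where
  measurable_state : ∀ k s, MeasurableSet {ω | St k ω = s}
  measurable_action : ∀ k a, MeasurableSet {ω | Ac k ω = a}
  init : ∀ᵐ ω ∂ℙ, St 1 ω = s₁
  action_law : ∀ k : ℕ, 1 ≤ k → ∀ (s : ℕ → S) (a : ℕ → A),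
    ℙ.real {ω | (∀ i ∈ Finset.Ico 1 k, St i ω = s i ∧ Ac i ω = a i) ∧
        St k ω = s k ∧ Ac k ω = a k}
      = π.prob (s k) (a k) *
        ℙ.real {ω | (∀ i ∈ Finset.Ico 1 k, St i ω = s i ∧ Ac i ω = a i) ∧ St k ω = s k}
  state_law : ∀ k : ℕ, 1 ≤ k → ∀ (s : ℕ → S) (a : ℕ → A),
    ℙ.real {ω | (∀ i ∈ Finset.Icc 1 k, St i ω = s i ∧ Ac i ω = a i) ∧ St (k + 1) ω = s (k + 1)}
      = M.trans (s k) (a k) (s (k + 1)) *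
        ℙ.real {ω | ∀ i ∈ Finset.Icc 1 k, St i ω = s i ∧ Ac i ω = a i}

/-- The iterates `Q_k`, `k ≥ 1`, of `Q`-learning with universal stepsizes `α_k = step k`
along the path `(s_k, a_k)_{k ≥ 1}`, started at `Q_1 = Q₁`. The value at index `0` is not used. -/
def qLearning (M : FiniteMDP S A) (step : ℕ → ℝ) (Q₁ : S × A → ℝ) (s : ℕ → S) (a : ℕ → A) :
    ℕ → S × A → ℝ
  | 0 => Q₁
  | 1 => Q₁
  | (k + 2) => fun x =>
      let Q := qLearning M step Q₁ s a (k + 1)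
      Q x + step (k + 1) * (if (s (k + 1), a (k + 1)) = x then 1 else 0) *
        (M.reward (s (k + 1)) (a (k + 1)) + maxQ Q (s (k + 2)) - Q (s (k + 1), a (k + 1)))

end FiniteMDP

end

/-! The algebraic fact behind everything is that the residual of the asynchronous operator is `D
(H(Q) - Q)`, coordinate by coordinate. If `D` is a multiple of the identity, the two residuals are
constant together. If both are constant, with `H(Q) - Q = c`, then `Q` solves the average-reward
optimality equation, so `c = r*` (`optimalAverageReward_eq`). For `c ≠ 0` the entries of `D` must
then all be equal, and since they sum to one, `D` is the uniform matrix.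

For the convergence, the asynchronous operator is again a span contraction, with factor `b = 1 - δ
(1 - β)` where `δ` is the smallest entry of `D` (`asyncBellman_spanContraction`). It therefore has a
fixed point `Qbar` modulo constants. What remains is stochastic approximation with Markovian noise
in a seminorm that is not smooth, so the square of the error cannot be expanded around a martingale
increment. The noise is removed before the seminorm is applied:

Solutions `φ t` of the Poisson equation for the indicators of the states split each increment into
the drift, a martingale difference, and a difference of terms at consecutive states
(`tdIncrement_eq`). The martingale differences are averaged with the stepsizes into `averagedNoise`,
whose coordinates are real-valued, so orthogonality gives their second moments. Subtracting this
average and adding the boundary term of the summation by parts gives `correctedError`, which obeys a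
contracting recursion along every path, up to the averaged noise and terms of order `step k ^ 2 *
log`.

No boundedness of the iterates is needed: an update raises the sup norm by at most the stepsize, so
the iterates grow at most logarithmically (`abs_qLearning_le`). This growth produces the factor `log
^ 2` in the rate. Both second moments satisfy the same scalar recursion, solved by
`le_div_of_stepsize_recursion`.

Finally, mean-square limits are unique modulo constants. A solution of the original equation that
attracted the iterates would also solve the asynchronous one, contradicting disjointness. -/

noncomputable section

/-! ### The span seminorm and fixed points modulo constants -/

section SpanSeminorm

variable {ι : Type*} [Fintype ι] [Nonempty ι]

theorem spanSeminorm_le_iff {x : ι → ℝ} {r : ℝ} :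
    spanSeminorm x ≤ r ↔ ∀ i j, x i - x j ≤ 2 * r := by
  unfold spanSeminorm
  constructor
  · intro h i j
    have h1 := Finset.le_sup' x (Finset.mem_univ i)
    have h2 := Finset.inf'_le x (Finset.mem_univ j)
    linarith
  · intro h
    obtain ⟨i, -, hi⟩ := Finset.exists_mem_eq_sup' Finset.univ_nonempty x
    obtain ⟨j, -, hj⟩ := Finset.exists_mem_eq_inf' Finset.univ_nonempty x
    rw [hi, hj]
    linarith [h i j]

theorem sub_le_two_mul_spanSeminorm (x : ι → ℝ) (i j : ι) : x i - x j ≤ 2 * spanSeminorm x :=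
  spanSeminorm_le_iff.1 le_rfl i j

theorem spanSeminorm_nonneg (x : ι → ℝ) : 0 ≤ spanSeminorm x := by
  have i := Classical.arbitrary ι
  linarith [sub_le_two_mul_spanSeminorm x i i]

theorem spanSeminorm_add_le (x y : ι → ℝ) :
    spanSeminorm (x + y) ≤ spanSeminorm x + spanSeminorm y := by
  rw [spanSeminorm_le_iff]
  intro i j
  have h1 := sub_le_two_mul_spanSeminorm x i j
  have h2 := sub_le_two_mul_spanSeminorm y i j
  simp only [Pi.add_apply]
  linarith

theorem spanSeminorm_smul_le {c : ℝ} (hc : 0 ≤ c) (x : ι → ℝ) :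
    spanSeminorm (c • x) ≤ c * spanSeminorm x := by
  rw [spanSeminorm_le_iff]
  intro i j
  have h1 := mul_le_mul_of_nonneg_left (sub_le_two_mul_spanSeminorm x i j) hc
  simp only [Pi.smul_apply, smul_eq_mul]
  linarith

theorem spanSeminorm_neg (x : ι → ℝ) : spanSeminorm (-x) = spanSeminorm x := by
  apply le_antisymm <;> rw [spanSeminorm_le_iff] <;> intro i j
  · have := sub_le_two_mul_spanSeminorm x j i
    simp only [Pi.neg_apply]; linarith
  · have := sub_le_two_mul_spanSeminorm (-x) j i
    simp only [Pi.neg_apply] at this; linarith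

theorem spanSeminorm_sub_le (x y : ι → ℝ) :
    spanSeminorm (x - y) ≤ spanSeminorm x + spanSeminorm y := by
  rw [sub_eq_add_neg, ← spanSeminorm_neg y]
  exact spanSeminorm_add_le _ _

theorem spanSeminorm_le_of_abs_le {x : ι → ℝ} {r : ℝ} (h : ∀ i, |x i| ≤ r) :
    spanSeminorm x ≤ r := by
  rw [spanSeminorm_le_iff]
  intro i j
  linarith [(abs_le.1 (h i)).2, (abs_le.1 (h j)).1]

theorem spanSeminorm_le_norm (x : ι → ℝ) : spanSeminorm x ≤ ‖x‖ :=
  spanSeminorm_le_of_abs_le fun i => norm_le_pi_norm x i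

theorem spanSeminorm_eq_zero_iff {x : ι → ℝ} :
    spanSeminorm x = 0 ↔ ∃ c : ℝ, ∀ i, x i = c := by
  constructor
  · intro h
    refine ⟨x (Classical.arbitrary ι), fun i => ?_⟩
    have h1 := sub_le_two_mul_spanSeminorm x i (Classical.arbitrary ι)
    have h2 := sub_le_two_mul_spanSeminorm x (Classical.arbitrary ι) i
    linarith
  · rintro ⟨c, hc⟩
    refine le_antisymm (spanSeminorm_le_iff.2 fun i j => ?_) (spanSeminorm_nonneg x)
    simp [hc]

theorem spanSeminorm_sq_le_sum_sq (x : ι → ℝ) : spanSeminorm x ^ 2 ≤ ∑ i, x i ^ 2 := by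
  have hs : 0 ≤ ∑ i, x i ^ 2 := Finset.sum_nonneg fun i _ => sq_nonneg _
  have h : spanSeminorm x ≤ √(∑ i, x i ^ 2) := by
    refine spanSeminorm_le_of_abs_le fun i => Real.abs_le_sqrt ?_
    exact Finset.single_le_sum (f := fun i => x i ^ 2) (fun i _ => sq_nonneg _)
      (Finset.mem_univ i)
  calc spanSeminorm x ^ 2 ≤ √(∑ i, x i ^ 2) ^ 2 := by
        gcongr
        exact spanSeminorm_nonneg x
    _ = _ := Real.sq_sqrt hs

/-- A self-map that contracts the span seminorm has a fixed point modulo constants. -/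
theorem exists_spanSeminorm_map_sub_eq_zero {f : (ι → ℝ) → ι → ℝ} {b : ℝ} (hb0 : 0 ≤ b)
    (hb1 : b < 1) (hf : ∀ x y, spanSeminorm (f x - f y) ≤ b * spanSeminorm (x - y)) :
    ∃ x, spanSeminorm (f x - x) = 0 := by
  let i₀ := Classical.arbitrary ι
  -- Normalizing at `i₀` leaves the span unchanged and picks one representative modulo constants; a
  -- fixed point of `g` has `f x - x` equal to the constant `f x i₀`.
  let g : (ι → ℝ) → ι → ℝ := fun x i => f x i - f x i₀
  have hgs : ∀ x y, spanSeminorm (g x - g y) ≤ b * spanSeminorm (x - y) := by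
    intro x y
    refine le_trans (spanSeminorm_le_iff.2 fun i j => ?_) (hf x y)
    have := sub_le_two_mul_spanSeminorm (f x - f y) i j
    simp only [Pi.sub_apply, g] at this ⊢
    linarith
  have hit : ∀ (n : ℕ) (x y), spanSeminorm (g^[n] x - g^[n] y) ≤ b ^ n * spanSeminorm (x - y) := by
    intro n
    induction n with
    | zero => simp
    | succ n ih =>
      intro x y
      rw [Function.iterate_succ_apply', Function.iterate_succ_apply']
      calc _ ≤ _ := hgs _ _
        _ ≤ b * (b ^ n * spanSeminorm (x - y)) := by gcongr; exact ih x y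
        _ = _ := by ring
  obtain ⟨n, hn⟩ : ∃ n : ℕ, b ^ n < 1 / 4 := exists_pow_lt_of_lt_one (by norm_num) hb1
  -- On vectors vanishing at `i₀` the sup norm is at most twice the span, so the factor `1 / 4` in
  -- span gives `1 / 2` in norm. The exponent `n + 1` guarantees a last application of `g`, which
  -- makes the value at `i₀` zero.
  have hc : ContractingWith (1 / 2 : NNReal) g^[n + 1] := by
    refine ⟨NNReal.half_lt_self one_ne_zero,
      LipschitzWith.of_dist_le_mul fun x y => ?_⟩
    rw [dist_eq_norm, dist_eq_norm, pi_norm_le_iff_of_nonneg (by positivity)]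
    intro i
    have h1 := hit (n + 1) x y
    have h2 : b ^ (n + 1) ≤ 1 / 4 := (pow_le_pow_of_le_one hb0 hb1.le n.le_succ).trans hn.le
    have h3 := spanSeminorm_le_norm (x - y)
    have h4 : b ^ (n + 1) * spanSeminorm (x - y) ≤ 1 / 4 * ‖x - y‖ :=
      mul_le_mul h2 h3 (spanSeminorm_nonneg _) (by norm_num)
    have h0 : ∀ z, g^[n + 1] z i₀ = 0 := by
      intro z
      rw [Function.iterate_succ_apply']
      simp [g]
    have h5 := sub_le_two_mul_spanSeminorm (g^[n + 1] x - g^[n + 1] y) i i₀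
    have h6 := sub_le_two_mul_spanSeminorm (g^[n + 1] x - g^[n + 1] y) i₀ i
    simp only [Pi.sub_apply, h0] at h5 h6
    rw [Real.norm_eq_abs, abs_le]
    push_cast
    constructor <;> simp only [Pi.sub_apply] <;> linarith
  refine ⟨hc.fixedPoint, ?_⟩
  have hfix := hc.isFixedPt_fixedPoint_iterate
  rw [spanSeminorm_eq_zero_iff]
  refine ⟨f hc.fixedPoint i₀, fun i => ?_⟩
  have := congrFun hfix i
  simp only [g] at this
  simp only [Pi.sub_apply]
  linarith

end SpanSeminorm

/-! ### Averages under stochastic vectors and matrices -/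

theorem stdSimplex_sum_mul_le_add {ι : Type*} [Fintype ι] {w f g : ι → ℝ} {c : ℝ}
    (hw : w ∈ stdSimplex ℝ ι) (h : ∀ i, f i ≤ g i + c) :
    ∑ i, w i * f i ≤ ∑ i, w i * g i + c := by
  calc ∑ i, w i * f i ≤ ∑ i, w i * (g i + c) :=
        Finset.sum_le_sum fun i _ => mul_le_mul_of_nonneg_left (h i) (hw.1 i)
    _ = ∑ i, w i * g i + (∑ i, w i) * c := by
        simp only [mul_add, Finset.sum_add_distrib, Finset.sum_mul]
    _ = _ := by rw [hw.2, one_mul]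

theorem stdSimplex_abs_sum_mul_le {ι : Type*} [Fintype ι] {w f : ι → ℝ} {c : ℝ}
    (hw : w ∈ stdSimplex ℝ ι) (h : ∀ i, |f i| ≤ c) : |∑ i, w i * f i| ≤ c := by
  rw [abs_le]
  have h1 := stdSimplex_sum_mul_le_add (f := f) (g := 0) (c := c) hw
    fun i => by simpa using (abs_le.1 (h i)).2
  have h2 := stdSimplex_sum_mul_le_add (f := 0) (g := f) (c := c) hw
    fun i => by simpa using by linarith [(abs_le.1 (h i)).1]
  simp at h1 h2
  constructor <;> linarith

section Stochastic

variable {S : Type*} [Fintype S] [DecidableEq S] {P : Matrix S S ℝ}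

theorem row_mem_stdSimplex (hP : P ∈ Matrix.rowStochastic ℝ S) (s : S) :
    P s ∈ stdSimplex ℝ S :=
  ⟨fun _ => Matrix.nonneg_of_mem_rowStochastic hP, Matrix.sum_row_of_mem_rowStochastic hP s⟩

/-- Applying `P ^ k` to the hypothesis makes the potential terms telescope. -/
theorem sum_pow_mulVec_le (hP : P ∈ Matrix.rowStochastic ℝ S) {g v : S → ℝ} {c : ℝ}
    (h : ∀ s, g s ≤ v s - (P *ᵥ v) s + c) (s : S) (K : ℕ) :
    ∑ k ∈ Finset.Icc 1 K, (P ^ (k - 1) *ᵥ g) s ≤ v s - (P ^ K *ᵥ v) s + K * c := by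
  induction K with
  | zero => simp
  | succ K ih =>
    rw [Finset.sum_Icc_succ_top (by omega)]
    have h1 : (P ^ K *ᵥ g) s ≤ (P ^ K *ᵥ (v - P *ᵥ v)) s + c :=
      stdSimplex_sum_mul_le_add (row_mem_stdSimplex (pow_mem hP K) s) h
    rw [Matrix.mulVec_sub, Matrix.mulVec_mulVec, ← pow_succ, Pi.sub_apply] at h1
    simp only [add_tsub_cancel_right]
    push_cast
    linarith

theorem average_pow_mulVec_le (hP : P ∈ Matrix.rowStochastic ℝ S) {g v : S → ℝ} {c : ℝ}
    (h : ∀ s, g s ≤ v s - (P *ᵥ v) s + c) (s : S) {K : ℕ} (hK : 0 < K) :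
    (1 / (K : ℝ)) * ∑ k ∈ Finset.Icc 1 K, (P ^ (k - 1) *ᵥ g) s ≤ c + 2 * ‖v‖ / K := by
  have hK' : (0 : ℝ) < K := by exact_mod_cast hK
  have h3 := sum_pow_mulVec_le hP h s K
  have h4 := abs_le.1 (stdSimplex_abs_sum_mul_le (row_mem_stdSimplex (pow_mem hP K) s)
    fun i => norm_le_pi_norm v i)
  have h5 := abs_le.1 (norm_le_pi_norm v s)
  have h6 : (P ^ K *ᵥ v) s = ∑ i, (P ^ K) s i * v i := rfl
  calc _ ≤ (1 / (K : ℝ)) * (2 * ‖v‖ + K * c) := by gcongr; linarith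
    _ = _ := by field_simp; ring

theorem tendsto_average_pow_mulVec (hP : P ∈ Matrix.rowStochastic ℝ S) {g v : S → ℝ} {c : ℝ}
    (h : ∀ s, g s = v s - (P *ᵥ v) s + c) (s : S) :
    Tendsto (fun K : ℕ => (1 / (K : ℝ)) * ∑ k ∈ Finset.Icc 1 K, (P ^ (k - 1) *ᵥ g) s)
      atTop (𝓝 c) := by
  have hlim : ∀ d : ℝ, Tendsto (fun K : ℕ => c + d / (K : ℝ)) atTop (𝓝 c) := fun d => by
    simpa using tendsto_const_nhds.add (tendsto_const_div_atTop_nhds_zero_nat d)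
  refine tendsto_of_tendsto_of_tendsto_of_le_of_le' (hlim (-(2 * ‖v‖))) (hlim (2 * ‖v‖)) ?_ ?_
  · filter_upwards [eventually_gt_atTop 0] with K hK
    have := average_pow_mulVec_le hP (g := -g) (v := -v) (c := -c)
      (fun s => by simp only [Matrix.mulVec_neg, Pi.neg_apply, h s]; linarith) s hK
    simp only [Matrix.mulVec_neg, Pi.neg_apply, Finset.sum_neg_distrib, norm_neg] at this
    rw [neg_div]
    linarith
  · filter_upwards [eventually_gt_atTop 0] with K hK
    exact average_pow_mulVec_le hP (fun s => (h s).le) s hK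

end Stochastic

namespace FiniteMDP

theorem abs_reward_le {S A : Type*} [Fintype S] (M : FiniteMDP S A) (s : S) (a : A) :
    |M.reward s a| ≤ 1 :=
  abs_le.2 ⟨(M.reward_mem s a).1, (M.reward_mem s a).2⟩

/-! ### Monotonicity and nonexpansiveness of the Bellman operator -/

section Bellman

variable {S A : Type*} [Fintype A] [Nonempty A]

theorem le_maxQ (Q : S × A → ℝ) (s : S) (a : A) : Q (s, a) ≤ maxQ Q s :=
  Finset.le_sup' (fun a => Q (s, a)) (Finset.mem_univ a)

theorem exists_eq_maxQ (Q : S × A → ℝ) (s : S) : ∃ a, maxQ Q s = Q (s, a) := by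
  obtain ⟨a, -, h⟩ := Finset.exists_mem_eq_sup' Finset.univ_nonempty fun a => Q (s, a)
  exact ⟨a, h⟩

theorem maxQ_le_add {Q₁ Q₂ : S × A → ℝ} {c : ℝ} (h : ∀ x, Q₁ x ≤ Q₂ x + c) (s : S) :
    maxQ Q₁ s ≤ maxQ Q₂ s + c := by
  obtain ⟨a, ha⟩ := exists_eq_maxQ Q₁ s
  rw [ha]
  linarith [h (s, a), le_maxQ Q₂ s a]

theorem abs_maxQ_le {Q : S × A → ℝ} {c : ℝ} (h : ∀ x, |Q x| ≤ c) (s : S) : |maxQ Q s| ≤ c := by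
  obtain ⟨a, ha⟩ := exists_eq_maxQ Q s
  rw [ha]
  exact h _

variable [Fintype S] (M : FiniteMDP S A)

theorem bellman_le_add {Q₁ Q₂ : S × A → ℝ} {c : ℝ} (h : ∀ x, Q₁ x ≤ Q₂ x + c) (x : S × A) :
    M.bellman Q₁ x ≤ M.bellman Q₂ x + c := by
  have := stdSimplex_sum_mul_le_add (M.trans_mem x.1 x.2) (maxQ_le_add h)
  simp only [bellman]
  linarith

theorem abs_bellman_sub_le {Q₁ Q₂ : S × A → ℝ} {c : ℝ} (h : ∀ x, |Q₁ x - Q₂ x| ≤ c)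
    (x : S × A) : |M.bellman Q₁ x - M.bellman Q₂ x| ≤ c := by
  have h1 := M.bellman_le_add
    (fun x => by linarith [(abs_le.1 (h x)).2] : ∀ x, Q₁ x ≤ Q₂ x + c) x
  have h2 := M.bellman_le_add
    (fun x => by linarith [(abs_le.1 (h x)).1] : ∀ x, Q₂ x ≤ Q₁ x + c) x
  rw [abs_le]
  constructor <;> linarith

theorem abs_bellman_le {Q : S × A → ℝ} {c : ℝ} (h : ∀ x, |Q x| ≤ c) (x : S × A) :
    |M.bellman Q x| ≤ 1 + c :=
  (abs_add_le _ _).trans (add_le_add (M.abs_reward_le _ _)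
    (stdSimplex_abs_sum_mul_le (M.trans_mem _ _) (abs_maxQ_le h)))

theorem bellman_eq_add {Q₁ Q₂ : S × A → ℝ} {c : ℝ} (h : ∀ x, Q₁ x = Q₂ x + c) (x : S × A) :
    M.bellman Q₁ x = M.bellman Q₂ x + c := by
  have h1 := M.bellman_le_add (fun x => (h x).le) x
  have h2 := M.bellman_le_add (fun x => by linarith [h x] : ∀ x, Q₂ x ≤ Q₁ x + -c) x
  linarith

end Bellman

/-! ### The average-reward optimality equation -/

section OptimalReward

variable {S A : Type*} [Fintype S] [Fintype A] (M : FiniteMDP S A)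

theorem stateMatrix_mem_rowStochastic [DecidableEq S] (π : Policy S A) :
    M.stateMatrix π ∈ Matrix.rowStochastic ℝ S := by
  rw [Matrix.mem_rowStochastic_iff_sum]
  constructor
  · intro s s'
    exact Finset.sum_nonneg fun a _ => mul_nonneg ((π.prob_mem s).1 a) ((M.trans_mem s a).1 s')
  · intro s
    simp only [stateMatrix, Matrix.of_apply]
    rw [Finset.sum_comm]
    simp only [← Finset.mul_sum, (M.trans_mem _ _).2, mul_one, (π.prob_mem s).2]

theorem stateMatrix_mulVec (π : Policy S A) (v : S → ℝ) (s : S) :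
    (M.stateMatrix π *ᵥ v) s = ∑ a, π.prob s a * ∑ s', M.trans s a s' * v s' := by
  simp only [Matrix.mulVec, dotProduct, stateMatrix, Matrix.of_apply, Finset.sum_mul,
    Finset.mul_sum, mul_assoc]
  exact Finset.sum_comm

theorem policy_reward_add [Nonempty A] (π : Policy S A) {Q : S × A → ℝ} {c : ℝ}
    (h : ∀ x, M.bellman Q x = Q x + c) (s : S) :
    ∑ a, π.prob s a * M.reward s a + (M.stateMatrix π *ᵥ maxQ Q) s
      = ∑ a, π.prob s a * Q (s, a) + c := by
  rw [stateMatrix_mulVec, ← Finset.sum_add_distrib]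
  calc _ = ∑ a, π.prob s a * M.bellman Q (s, a) := by simp only [← mul_add]; rfl
    _ = ∑ a, π.prob s a * Q (s, a) + (∑ a, π.prob s a) * c := by
        simp only [h, mul_add, Finset.sum_add_distrib, Finset.sum_mul]
    _ = _ := by rw [(π.prob_mem s).2, one_mul]

/-- A solution of the average-reward optimality equation identifies the optimal average reward. -/
theorem optimalAverageReward_eq [DecidableEq S] [Nonempty S] [Nonempty A]
    {Q : S × A → ℝ} {c : ℝ} (h : ∀ x, M.bellman Q x = Q x + c) :
    M.optimalAverageReward = c := by
  classical
  apply IsGreatest.csSup_eq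
  constructor
  · choose b hb using exists_eq_maxQ Q
    -- The greedy policy turns the optimality equation into a Poisson equation with potential `maxQ
    -- Q`, so its average reward is exactly `c`. For any other policy the same potential gives an
    -- inequality.
    let π : Policy S A := ⟨fun s => Pi.single (b s) 1, fun s => single_mem_stdSimplex ℝ (b s)⟩
    refine ⟨π, Classical.arbitrary S, ?_⟩
    refine tendsto_average_pow_mulVec (v := maxQ Q) (M.stateMatrix_mem_rowStochastic π)
      (fun s => ?_) _
    have h1 := M.policy_reward_add π h s
    have h2 : ∑ a, π.prob s a * Q (s, a) = maxQ Q s := by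
      simp [π, Pi.single_apply, hb]
    linarith
  · rintro r ⟨π, s, hr⟩
    have hlim : Tendsto (fun K : ℕ => c + 2 * ‖maxQ Q‖ / (K : ℝ)) atTop (𝓝 c) := by
      simpa using tendsto_const_nhds.add (tendsto_const_div_atTop_nhds_zero_nat (2 * ‖maxQ Q‖))
    refine le_of_tendsto_of_tendsto hr hlim ?_
    filter_upwards [eventually_gt_atTop 0] with K hK
    refine average_pow_mulVec_le (M.stateMatrix_mem_rowStochastic π) (fun s => ?_) s hK
    have h1 := M.policy_reward_add π h s
    have h2 := stdSimplex_sum_mul_le_add (g := 0) (c := maxQ Q s) (π.prob_mem s)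
      fun a => by simpa using le_maxQ Q s a
    simp only [Pi.zero_apply, mul_zero, Finset.sum_const_zero, zero_add] at h2
    linarith

end OptimalReward

/-! ### The asynchronous operator: contraction and solution sets -/

section Async

theorem asyncBellman_apply {S A : Type*} [Fintype S] [DecidableEq S] [Fintype A] [DecidableEq A]
    [Nonempty A] (M : FiniteMDP S A) (π : Policy S A) (μ : S → ℝ) (Q : S × A → ℝ) (x : S × A) :
    M.asyncBellman π μ Q x = Q x + μ x.1 * π.prob x.1 x.2 * (M.bellman Q x - Q x) := by
  simp only [asyncBellman, visitMatrix, Pi.add_apply, Matrix.sub_mulVec, Matrix.one_mulVec,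
    Pi.sub_apply, Matrix.mulVec_diagonal]
  ring

variable {S A : Type*} [Fintype S] [Fintype A] {M : FiniteMDP S A} {π : Policy S A} {μ : S → ℝ}

theorem visit_sum (hμ : μ ∈ stdSimplex ℝ S) : ∑ x : S × A, μ x.1 * π.prob x.1 x.2 = 1 := by
  rw [Fintype.sum_prod_type]
  simp only [← Finset.mul_sum, (π.prob_mem _).2, mul_one, hμ.2]

variable [DecidableEq S]

theorem stationary_pos (hπ : M.ErgodicPolicy π) (hμ : M.IsStationary π μ) (s : S) : 0 < μ s := by
  have hP := M.stateMatrix_mem_rowStochastic π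
  obtain ⟨t, ht⟩ : ∃ t, 0 < μ t := by
    by_contra! h
    have := hμ.1.2
    linarith [Finset.sum_nonpos fun t (_ : t ∈ Finset.univ) => h t]
  obtain ⟨n, -, hn⟩ := (Matrix.isIrreducible_iff_exists_pow_pos
    fun _ _ => Matrix.nonneg_of_mem_rowStochastic hP).1 hπ.irreducible t s
  have hinv : ∀ n : ℕ, μ ᵥ* M.stateMatrix π ^ n = μ := by
    intro n
    induction n with
    | zero => simp
    | succ n ih => rw [pow_succ, ← Matrix.vecMul_vecMul, ih, hμ.2]
  rw [← hinv n]
  refine lt_of_lt_of_le (mul_pos ht hn) ?_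
  exact Finset.single_le_sum (f := fun t => μ t * (M.stateMatrix π ^ n) t s)
    (fun i _ => mul_nonneg (hμ.1.1 i) (Matrix.nonneg_of_mem_rowStochastic (pow_mem hP n)))
    (Finset.mem_univ t)

theorem visit_pos (hπ : M.ErgodicPolicy π) (hμ : M.IsStationary π μ) (x : S × A) :
    0 < μ x.1 * π.prob x.1 x.2 :=
  mul_pos (stationary_pos hπ hμ _) (hπ.prob_pos _ _)

variable [Nonempty S] [DecidableEq A] [Nonempty A]

/-- Let `[V, U]` be the range of `Q₁ - Q₂`. Monotonicity keeps the Bellman difference inside `[V,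
U]`, so in each coordinate its visit weight may be lowered to the common minimum `δ` when bounding
above by `U` or below by `V`. With a common weight, the span contraction of the Bellman operator
applies, although the true weights differ. -/
theorem asyncBellman_spanContraction (hM : M.SpanContraction) (hπ : M.ErgodicPolicy π)
    (hμ : M.IsStationary π μ) : ∃ b : ℝ, 0 ≤ b ∧ b < 1 ∧ ∀ Q₁ Q₂ : S × A → ℝ,
      spanSeminorm (M.asyncBellman π μ Q₁ - M.asyncBellman π μ Q₂)
        ≤ b * spanSeminorm (Q₁ - Q₂) := by
  obtain ⟨β, hβ0, hβ1, hβ⟩ := hM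
  have hd := visit_pos hπ hμ
  have hd1 : ∀ x : S × A, μ x.1 * π.prob x.1 x.2 ≤ 1 := fun x =>
    (Finset.single_le_sum (f := fun x : S × A => μ x.1 * π.prob x.1 x.2)
      (fun x _ => (hd x).le) (Finset.mem_univ x)).trans (visit_sum hμ.1).le
  obtain ⟨x₀, hx₀⟩ := Finite.exists_min fun x : S × A => μ x.1 * π.prob x.1 x.2
  set δ := μ x₀.1 * π.prob x₀.1 x₀.2
  have hδ0 : 0 < δ := hd x₀
  have hδ1 : δ ≤ 1 := hd1 x₀
  refine ⟨1 - δ * (1 - β), by nlinarith, by nlinarith, fun Q₁ Q₂ => ?_⟩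
  obtain ⟨u, hu⟩ := Finite.exists_max (Q₁ - Q₂)
  obtain ⟨l, hl⟩ := Finite.exists_min (Q₁ - Q₂)
  have hspan := sub_le_two_mul_spanSeminorm (Q₁ - Q₂) u l
  rw [spanSeminorm_le_iff]
  intro i j
  set U := (Q₁ - Q₂) u
  set V := (Q₁ - Q₂) l
  have hUV : 2 * spanSeminorm (Q₁ - Q₂) ≤ U - V := by
    have : spanSeminorm (Q₁ - Q₂) ≤ (U - V) / 2 :=
      spanSeminorm_le_iff.2 fun i j => by linarith [hu i, hl j]
    linarith
  have hHU := M.bellman_le_add (Q₁ := Q₁) (Q₂ := Q₂) (c := U) fun x => by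
    have := hu x; simp only [Pi.sub_apply] at this; linarith
  have hHV := M.bellman_le_add (Q₁ := Q₂) (Q₂ := Q₁) (c := -V) fun x => by
    have := hl x; simp only [Pi.sub_apply] at this; linarith
  have hH := (sub_le_two_mul_spanSeminorm _ i j).trans
    (mul_le_mul_of_nonneg_left (hβ Q₁ Q₂) zero_le_two)
  have hui := hu i
  have hlj := hl j
  have hx1 := mul_nonneg (sub_nonneg.2 (hd1 i)) (sub_nonneg.2 (hu i))
  have hx2 := mul_nonneg (sub_nonneg.2 (hd1 j)) (sub_nonneg.2 (hl j))
  have hx3 := mul_nonneg (sub_nonneg.2 (hx₀ i)) (sub_nonneg.2 (hHU i))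
  have hx4 := mul_nonneg (sub_nonneg.2 (hx₀ j)) (sub_nonneg.2 (hHV j))
  simp only [Pi.sub_apply, asyncBellman_apply] at hH hx1 hx2 hx3 hx4 ⊢
  have hx5 := mul_le_mul_of_nonneg_left hH hδ0.le
  nlinarith

theorem setOf_asyncBellman_eq_of_uniform (hD : visitMatrix π μ
    = (1 / ((Fintype.card S : ℝ) * (Fintype.card A : ℝ))) • (1 : Matrix (S × A) (S × A) ℝ)) :
    {Q : S × A → ℝ | spanSeminorm (M.asyncBellman π μ Q - Q) = 0}
      = {Q : S × A → ℝ | spanSeminorm (M.bellman Q - Q) = 0} := by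
  have hd : ∀ x : S × A,
      μ x.1 * π.prob x.1 x.2 = 1 / ((Fintype.card S : ℝ) * (Fintype.card A : ℝ)) := fun x => by
    simpa [visitMatrix] using congrFun (congrFun hD x) x
  set r := 1 / ((Fintype.card S : ℝ) * (Fintype.card A : ℝ)) with hr
  have hr0 : r ≠ 0 := by rw [hr]; positivity
  ext Q
  simp only [Set.mem_ofPred_eq, spanSeminorm_eq_zero_iff, Pi.sub_apply, asyncBellman_apply, hd,
    add_sub_cancel_left]
  constructor
  · rintro ⟨c, hc⟩
    exact ⟨r⁻¹ * c, fun x => by rw [← hc x]; field_simp⟩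
  · rintro ⟨c, hc⟩
    exact ⟨r * c, fun x => by rw [hc x]⟩

theorem setOf_asyncBellman_inter_eq_empty (hμ : M.IsStationary π μ) (hD : visitMatrix π μ
      ≠ (1 / ((Fintype.card S : ℝ) * (Fintype.card A : ℝ))) • (1 : Matrix (S × A) (S × A) ℝ))
    (hr : M.optimalAverageReward ≠ 0) :
    {Q : S × A → ℝ | spanSeminorm (M.asyncBellman π μ Q - Q) = 0}
      ∩ {Q : S × A → ℝ | spanSeminorm (M.bellman Q - Q) = 0} = ∅ := by
  rw [Set.eq_empty_iff_forall_notMem]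
  rintro Q ⟨h1, h2⟩
  simp only [Set.mem_ofPred_eq, spanSeminorm_eq_zero_iff, Pi.sub_apply, asyncBellman_apply,
    add_sub_cancel_left] at h1 h2
  obtain ⟨c', hc'⟩ := h1
  obtain ⟨c, hc⟩ := h2
  have hc0 : c ≠ 0 := by
    rwa [M.optimalAverageReward_eq (Q := Q) (c := c) fun x => by linarith [hc x]] at hr
  -- All visit probabilities equal one number, which their sum `1` determines.
  have hd : ∀ x : S × A, μ x.1 * π.prob x.1 x.2 = c' / c := fun x => by
    rw [eq_div_iff hc0, ← hc' x, hc x]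
  have hsum := visit_sum (π := π) hμ.1
  simp only [hd, Finset.sum_const, Finset.card_univ, Fintype.card_prod, nsmul_eq_mul,
    Nat.cast_mul] at hsum
  apply hD
  rw [visitMatrix, ← Matrix.diagonal_one, ← Matrix.diagonal_smul]
  congr 1
  ext x
  simp only [hd, Pi.smul_apply, smul_eq_mul, mul_one]
  exact eq_one_div_of_mul_eq_one_right hsum

/-- The Bellman operator commutes with adding constants, so the residual depends on `Q` modulo
constants only. -/
theorem spanSeminorm_asyncBellman_congr {Q Q' : S × A → ℝ} (h : spanSeminorm (Q - Q') = 0)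
    (hQ' : spanSeminorm (M.asyncBellman π μ Q' - Q') = 0) :
    spanSeminorm (M.asyncBellman π μ Q - Q) = 0 := by
  rw [spanSeminorm_eq_zero_iff] at *
  obtain ⟨c, hc⟩ := h
  obtain ⟨c', hc'⟩ := hQ'
  refine ⟨c', fun x => ?_⟩
  have h1 := M.bellman_eq_add (Q₁ := Q) (Q₂ := Q') (c := c)
    (fun x => by have := hc x; simp only [Pi.sub_apply] at this; linarith) x
  have h2 := hc x
  simp only [Pi.sub_apply, asyncBellman_apply, add_sub_cancel_left] at h2 hc' ⊢
  rw [← hc' x, h1, show Q x = Q' x + c by linarith]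
  ring

end Async

/-! ### The Poisson equation of an irreducible chain -/

section Poisson

variable {S : Type*} [Fintype S] [DecidableEq S] [Nonempty S] {P : Matrix S S ℝ}

/-- Maximum principle: at a maximum point `f` equals its average under `P ^ n`, so it attains the
maximum wherever that row is positive; irreducibility reaches every state. -/
theorem eq_of_mulVec_eq_self (hP : P ∈ Matrix.rowStochastic ℝ S) (hirr : P.IsIrreducible)
    {f : S → ℝ} (hf : P *ᵥ f = f) (s t : S) : f s = f t := by
  obtain ⟨u, hu⟩ := Finite.exists_max f
  suffices h : ∀ t, f t = f u by rw [h s, h t]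
  intro t
  obtain ⟨n, -, hn⟩ := (Matrix.isIrreducible_iff_exists_pow_pos
    fun _ _ => Matrix.nonneg_of_mem_rowStochastic hP).1 hirr u t
  have hinv : ∀ n : ℕ, P ^ n *ᵥ f = f := by
    intro n
    induction n with
    | zero => simp
    | succ n ih => rw [pow_succ, ← Matrix.mulVec_mulVec, hf, ih]
  have hPn := row_mem_stdSimplex (pow_mem hP n) u
  have hsum : ∑ i, (P ^ n) u i * (f u - f i) = 0 := by
    have h1 : ∑ i, (P ^ n) u i * f i = f u := congrFun (hinv n) u
    simp only [mul_sub, Finset.sum_sub_distrib, ← Finset.sum_mul, hPn.2, h1]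
    ring
  rw [Finset.sum_eq_zero_iff_of_nonneg
    fun i _ => mul_nonneg (hPn.1 i) (sub_nonneg.2 (hu i))] at hsum
  rcases mul_eq_zero.1 (hsum t (Finset.mem_univ t)) with h | h
  · exact absurd h hn.ne'
  · linarith

/-- The Poisson equation of an irreducible finite chain is solvable for centered functions. -/
theorem exists_poisson_solution (hP : P ∈ Matrix.rowStochastic ℝ S) (hirr : P.IsIrreducible)
    {μ : S → ℝ} (hμ : μ ∈ stdSimplex ℝ S) (hμP : μ ᵥ* P = μ) {f : S → ℝ} (hf : μ ⬝ᵥ f = 0) :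
    ∃ φ : S → ℝ, ∀ s, φ s - (P *ᵥ φ) s = f s := by
  let T : (S → ℝ) →ₗ[ℝ] S → ℝ := LinearMap.id - P.mulVecLin
  let m : (S → ℝ) →ₗ[ℝ] ℝ := dotProductBilin ℝ ℝ μ
  have hT : ∀ g, T g = g - P *ᵥ g := fun g => rfl
  have hm : ∀ g, m g = μ ⬝ᵥ g := fun g => rfl
  have hle : LinearMap.range T ≤ LinearMap.ker m := by
    rintro _ ⟨g, rfl⟩
    rw [LinearMap.mem_ker, hm, hT, dotProduct_sub, Matrix.dotProduct_mulVec, hμP, sub_self]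
  have hkerT : Module.finrank ℝ (LinearMap.ker T) ≤ 1 := by
    refine finrank_le_one ⟨fun _ => 1, ?_⟩ fun g => ?_
    · rw [LinearMap.mem_ker, hT, sub_eq_zero]
      exact (Matrix.one_vecMul_of_mem_rowStochastic hP).symm
    · have hg : P *ᵥ g.1 = g.1 := by
        have := g.2
        rw [LinearMap.mem_ker, hT, sub_eq_zero] at this
        exact this.symm
      refine ⟨g.1 (Classical.arbitrary S), Subtype.ext (funext fun s => ?_)⟩
      simpa using eq_of_mulVec_eq_self hP hirr hg _ s
  have hm1 : LinearMap.range m = ⊤ := by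
    rw [LinearMap.range_eq_top]
    intro r
    refine ⟨fun _ => r, ?_⟩
    rw [hm, dotProduct, ← Finset.sum_mul, hμ.2, one_mul]
  have h1 := LinearMap.finrank_range_add_finrank_ker T
  have h2 := LinearMap.finrank_range_add_finrank_ker m
  rw [hm1, finrank_top, Module.finrank_self] at h2
  -- The kernel of `T` is at most a line, so its range has codimension at most one, while the kernel
  -- of `m` has codimension one and contains it.
  have heq := Submodule.eq_of_le_of_finrank_le hle (by omega)
  have hfm : f ∈ LinearMap.range T := by rw [heq, LinearMap.mem_ker, hm, hf]
  obtain ⟨φ, hφ⟩ := hfm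
  exact ⟨φ, fun s => by rw [← hφ]; rfl⟩

end Poisson

end FiniteMDP

/-! ### Scalar stepsize recursions and logarithms -/

/-- With `t = k + h`, the conditions `2 ≤ c * α` and `C * α ^ 2 ≤ K` leave a net gain of at least `K
/ t ^ 2` per step, enough because `1 / t - 1 / t ^ 2 ≤ 1 / (t + 1)`. The bound `c * α ≤ h` keeps the
factor of `A k` nonnegative. -/
theorem le_div_of_stepsize_recursion {A Λ : ℕ → ℝ} {c C K α h : ℝ} (hΛ0 : ∀ k, 1 ≤ k → 0 ≤ Λ k)
    (hΛ : ∀ k, 1 ≤ k → Λ k ≤ Λ (k + 1)) (hh : 1 ≤ h) (hc : 2 ≤ c * α)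
    (hch : c * α ≤ h) (hC : C * α ^ 2 ≤ K) (hK : 0 ≤ K) (h1 : A 1 ≤ K * Λ 1 / (1 + h))
    (hA : ∀ k : ℕ, 1 ≤ k → A (k + 1) ≤ (1 - c * (α / (k + h))) * A k
      + C * (α / (k + h)) ^ 2 * Λ k) {k : ℕ} (hk : 1 ≤ k) : A k ≤ K * Λ k / (k + h) := by
  induction k, hk using Nat.le_induction with
  | base => simpa using h1
  | succ k hk ih =>
    have ht : (1 : ℝ) < k + h := by
      have : (1 : ℝ) ≤ k := by exact_mod_cast hk
      linarith
    have ht0 : (0 : ℝ) < k + h := by linarith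
    have hcoef : 0 ≤ 1 - c * (α / (k + h)) := by
      rw [← mul_div_assoc, sub_nonneg, div_le_one ht0]
      have : (0 : ℝ) ≤ k := Nat.cast_nonneg k
      linarith
    have hL := hΛ0 k hk
    push_cast
    set t := (k : ℝ) + h with ht_def
    calc A (k + 1) ≤ (1 - c * (α / t)) * (K * Λ k / t) + C * (α / t) ^ 2 * Λ k :=
          (hA k hk).trans (by gcongr)
      _ = Λ k * (K / t - (c * α * K - C * α ^ 2) / t ^ 2) := by field_simp; ring
      _ ≤ Λ k * (K / t - K / t ^ 2) := by
          gcongr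
          nlinarith
      _ ≤ Λ k * (K / (t + 1)) := by
          gcongr
          rw [div_sub_div _ _ ht0.ne' (by positivity),
            div_le_div_iff₀ (by positivity) (by positivity)]
          nlinarith [mul_nonneg hK ht0.le]
      _ ≤ Λ (k + 1) * (K / (t + 1)) := by
          gcongr
          exact hΛ k hk
      _ = K * Λ (k + 1) / (k + 1 + h) := by rw [ht_def]; ring

theorem log_succ_pos {k : ℕ} (hk : 1 ≤ k) : 0 < Real.log ((k : ℝ) + 1) :=
  Real.log_pos (by have : (1 : ℝ) ≤ k := by exact_mod_cast hk
                   linarith)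

theorem log_succ_mono {j k : ℕ} (hjk : j ≤ k) :
    Real.log ((j : ℝ) + 1) ≤ Real.log ((k : ℝ) + 1) := by
  gcongr

theorem inv_le_log_succ_sub (k : ℕ) :
    1 / ((k : ℝ) + 2) ≤ Real.log (((k + 1 : ℕ) : ℝ) + 1) - Real.log ((k : ℝ) + 1) := by
  have h1 : (0 : ℝ) < k + 1 := by positivity
  have h2 : (0 : ℝ) < k + 2 := by positivity
  push_cast
  rw [add_assoc, one_add_one_eq_two, ← Real.log_div h2.ne' h1.ne']
  refine le_trans (le_of_eq ?_) (Real.one_sub_inv_le_log_of_pos (by positivity))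
  field_simp
  ring

theorem log_succ_succ_le {k : ℕ} (hk : 1 ≤ k) :
    Real.log (((k + 1 : ℕ) : ℝ) + 1) ≤ 2 * Real.log ((k : ℝ) + 1) := by
  have h1 : (1 : ℝ) ≤ k := by exact_mod_cast hk
  rw [← Real.log_rpow (by positivity)]
  gcongr
  push_cast
  norm_num
  nlinarith

/-! ### Decomposition of the noise through the Poisson equation -/

namespace FiniteMDP

theorem policy_prob_le_one {S A : Type*} [Fintype A] (π : Policy S A) (s : S) (a : A) :
    π.prob s a ≤ 1 :=
  (Finset.single_le_sum (fun a _ => (π.prob_mem s).1 a) (Finset.mem_univ a)).trans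
    (π.prob_mem s).2.le

variable {S A : Type*} [Fintype S] [Fintype A] [Nonempty A] (M : FiniteMDP S A)

/-- The Bellman residual weighted by the policy. -/
def policyResidual (π : Policy S A) (Q : S × A → ℝ) (x : S × A) : ℝ :=
  π.prob x.1 x.2 * (M.bellman Q x - Q x)

variable {M} in
theorem abs_policyResidual_le {π : Policy S A} {B : ℝ} {Q : S × A → ℝ}
    (hQ : ∀ x, |Q x| ≤ B) (x : S × A) :
    |M.policyResidual π Q x| ≤ 1 + 2 * B := by
  have h1 := abs_le.1 (M.abs_bellman_le hQ x)
  have h2 := abs_le.1 (hQ x)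
  have h3 : |M.bellman Q x - Q x| ≤ 1 + 2 * B := abs_le.2 ⟨by linarith, by linarith⟩
  rw [policyResidual, abs_mul, abs_of_nonneg ((π.prob_mem _).1 _)]
  calc _ ≤ 1 * |M.bellman Q x - Q x| := by
        gcongr
        exact policy_prob_le_one _ _ _
    _ ≤ _ := by rwa [one_mul]

variable {M} in
theorem abs_policyResidual_sub_le {π : Policy S A} {B : ℝ} {Q Q' : S × A → ℝ}
    (hQ : ∀ x, |Q' x - Q x| ≤ B) (x : S × A) :
    |M.policyResidual π Q' x - M.policyResidual π Q x| ≤ 2 * B := by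
  have h1 := abs_le.1 (M.abs_bellman_sub_le hQ x)
  have h2 := abs_le.1 (hQ x)
  have h3 : |(M.bellman Q' x - M.bellman Q x) - (Q' x - Q x)| ≤ 2 * B :=
    abs_le.2 ⟨by linarith, by linarith⟩
  rw [policyResidual, policyResidual, ← mul_sub, abs_mul, abs_of_nonneg ((π.prob_mem _).1 _)]
  calc _ ≤ 1 * |(M.bellman Q' x - M.bellman Q x) - (Q' x - Q x)| := by
        rw [show M.bellman Q' x - Q' x - (M.bellman Q x - Q x)
          = (M.bellman Q' x - M.bellman Q x) - (Q' x - Q x) by ring]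
        gcongr
        exact policy_prob_le_one _ _ _
    _ ≤ _ := by rwa [one_mul]

variable [DecidableEq S] [DecidableEq A]

/-- The increment of `Q`-learning at a transition `(s, a, s')`. -/
def tdIncrement (Q : S × A → ℝ) (s : S) (a : A) (s' : S) (x : S × A) : ℝ :=
  (if (s, a) = x then 1 else 0) * (M.reward s a + maxQ Q s' - Q (s, a))

/-- The martingale part of the noise, with `φ t` in the role of a solution of the Poisson equation
of the chain of states for the indicator of `t`. -/
def martingaleNoise (π : Policy S A) (φ : S → S → ℝ) (Q : S × A → ℝ) (s : S) (a : A) (s' : S)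
    (x : S × A) : ℝ :=
  M.tdIncrement Q s a s' x - (if s = x.1 then 1 else 0) * M.policyResidual π Q x
    + M.policyResidual π Q x * (φ x.1 s' - (M.stateMatrix π *ᵥ φ x.1) s)

/-- The average of the martingale noise along a path with the weights of the stepsizes. -/
def averagedNoise (π : Policy S A) (φ : S → S → ℝ) (step : ℕ → ℝ) (Q₁ : S × A → ℝ) (s : ℕ → S)
    (a : ℕ → A) : ℕ → S × A → ℝ
  | 0 => 0
  | 1 => 0
  | (k + 2) => fun x => (1 - step (k + 1)) * averagedNoise π φ step Q₁ s a (k + 1) x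
      + step (k + 1) * M.martingaleNoise π φ (M.qLearning step Q₁ s a (k + 1)) (s (k + 1))
        (a (k + 1)) (s (k + 2)) x

/-- The iterates of `Q`-learning relative to `Qbar`, without the averaged noise and with the
telescoping part of the noise added. -/
def correctedError (π : Policy S A) (φ : S → S → ℝ) (step : ℕ → ℝ) (Q₁ Qbar : S × A → ℝ)
    (s : ℕ → S) (a : ℕ → A) (k : ℕ) (x : S × A) : ℝ :=
  M.qLearning step Q₁ s a k x - Qbar x - M.averagedNoise π φ step Q₁ s a k x
    + step k * (φ x.1 (s k) * M.policyResidual π (M.qLearning step Q₁ s a k) x)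

theorem qLearning_succ (step : ℕ → ℝ) (Q₁ : S × A → ℝ) (s : ℕ → S) (a : ℕ → A) {k : ℕ}
    (hk : 1 ≤ k) (x : S × A) :
    M.qLearning step Q₁ s a (k + 1) x = M.qLearning step Q₁ s a k x
      + step k * M.tdIncrement (M.qLearning step Q₁ s a k) (s k) (a k) (s (k + 1)) x := by
  obtain ⟨k, rfl⟩ := Nat.exists_eq_add_of_le' hk
  exact congrArg _ (mul_assoc _ _ _)

theorem averagedNoise_succ (π : Policy S A) (φ : S → S → ℝ) (step : ℕ → ℝ) (Q₁ : S × A → ℝ)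
    (s : ℕ → S) (a : ℕ → A) {k : ℕ} (hk : 1 ≤ k) (x : S × A) :
    M.averagedNoise π φ step Q₁ s a (k + 1) x = (1 - step k) * M.averagedNoise π φ step Q₁ s a k x
      + step k * M.martingaleNoise π φ (M.qLearning step Q₁ s a k) (s k) (a k) (s (k + 1)) x := by
  obtain ⟨k, rfl⟩ := Nat.exists_eq_add_of_le' hk
  rw [averagedNoise]

/-- Given the state, the mean increment at `x` is the weighted residual if the state is `x.1` and
zero otherwise, and the mean of `φ x.1` at the next state is its image under the state matrix. Hence
both brackets of the noise are centered. -/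
theorem sum_martingaleNoise (π : Policy S A) (φ : S → S → ℝ) (Q : S × A → ℝ) (s : S)
    (x : S × A) :
    ∑ a, π.prob s a * ∑ s', M.trans s a s' * M.martingaleNoise π φ Q s a s' x = 0 := by
  have h1 : ∀ a, ∑ s', M.trans s a s' * M.martingaleNoise π φ Q s a s' x
      = (if (s, a) = x then 1 else 0) * (M.bellman Q x - Q x)
        - (if s = x.1 then 1 else 0) * M.policyResidual π Q x
        + M.policyResidual π Q x
          * (∑ s', M.trans s a s' * φ x.1 s' - (M.stateMatrix π *ᵥ φ x.1) s) := by
    intro a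
    have hsum : ∀ c, ∑ s', M.trans s a s' * c = c := fun c => by
      rw [← Finset.sum_mul, (M.trans_mem s a).2, one_mul]
    have h2 : ∑ s', M.trans s a s' * M.tdIncrement Q s a s' x
        = (if (s, a) = x then 1 else 0) * (M.bellman Q x - Q x) := by
      by_cases h : (s, a) = x
      · subst h
        simp only [tdIncrement, if_true, one_mul, bellman, mul_add, mul_sub,
          Finset.sum_add_distrib, Finset.sum_sub_distrib, hsum]
      · simp [tdIncrement, h]
    rw [mul_sub (M.policyResidual π Q x), Finset.mul_sum]
    conv_rhs => rw [← h2, ← hsum ((if s = x.1 then 1 else 0) * M.policyResidual π Q x),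
      ← hsum (M.policyResidual π Q x * (M.stateMatrix π *ᵥ φ x.1) s)]
    simp only [← Finset.sum_add_distrib, ← Finset.sum_sub_distrib]
    refine Finset.sum_congr rfl fun s' _ => ?_
    rw [martingaleNoise]
    ring
  have hsum : ∀ c, ∑ a, π.prob s a * c = c := fun c => by
    rw [← Finset.sum_mul, (π.prob_mem s).2, one_mul]
  have h3 : ∑ a, π.prob s a * ((if (s, a) = x then 1 else 0) * (M.bellman Q x - Q x))
      = (if s = x.1 then 1 else 0) * M.policyResidual π Q x := by
    obtain ⟨t, b⟩ := x
    by_cases h : s = t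
    · subst h
      simp [policyResidual]
    · simp [h]
  have h4 : ∑ a, π.prob s a * (M.policyResidual π Q x * ∑ s', M.trans s a s' * φ x.1 s')
      = M.policyResidual π Q x * (M.stateMatrix π *ᵥ φ x.1) s := by
    rw [stateMatrix_mulVec, Finset.mul_sum]
    exact Finset.sum_congr rfl fun a _ => by ring
  calc _ = ∑ a, (π.prob s a * ((if (s, a) = x then 1 else 0) * (M.bellman Q x - Q x))
        - π.prob s a * ((if s = x.1 then 1 else 0) * M.policyResidual π Q x)
        + (π.prob s a * (M.policyResidual π Q x * ∑ s', M.trans s a s' * φ x.1 s')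
        - π.prob s a * (M.policyResidual π Q x * (M.stateMatrix π *ᵥ φ x.1) s))) :=
        Finset.sum_congr rfl fun a _ => by rw [h1]; ring
    _ = 0 := by
        rw [Finset.sum_add_distrib, Finset.sum_sub_distrib, Finset.sum_sub_distrib, hsum, hsum,
          h3, h4]
        ring

/-- The Poisson equation replaces the indicator of the current state by `μ x.1` plus `φ - P φ`;
adding and subtracting `φ` at the next state separates a centered part from a difference along the
path. -/
theorem tdIncrement_eq {π : Policy S A} {μ : S → ℝ} {φ : S → S → ℝ}
    (hφ : ∀ t s, φ t s - (M.stateMatrix π *ᵥ φ t) s = (if s = t then 1 else 0) - μ t)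
    (Q : S × A → ℝ) (s : S) (a : A) (s' : S) (x : S × A) :
    M.tdIncrement Q s a s' x = M.asyncBellman π μ Q x - Q x + M.martingaleNoise π φ Q s a s' x
      + φ x.1 s * M.policyResidual π Q x - φ x.1 s' * M.policyResidual π Q x := by
  rw [asyncBellman_apply, martingaleNoise]
  have h := hφ x.1 s
  rw [show (M.stateMatrix π *ᵥ φ x.1) s = φ x.1 s - ((if s = x.1 then 1 else 0) - μ x.1) by
    linarith]
  rw [policyResidual]
  ring

/-- Summation by parts: the boundary term in `correctedError` absorbs the path difference, leaving
only changes of the stepsize and of the residual, all of second order in the stepsize up to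
logarithms. -/
theorem correctedError_succ {π : Policy S A} {μ : S → ℝ} {φ : S → S → ℝ}
    (hφ : ∀ t s, φ t s - (M.stateMatrix π *ᵥ φ t) s = (if s = t then 1 else 0) - μ t)
    (step : ℕ → ℝ) (Q₁ Qbar : S × A → ℝ) (s : ℕ → S) (a : ℕ → A) {k : ℕ} (hk : 1 ≤ k)
    (x : S × A) :
    M.correctedError π φ step Q₁ Qbar s a (k + 1) x
      = (1 - step k) * M.correctedError π φ step Q₁ Qbar s a k x
        + step k * (M.asyncBellman π μ (M.qLearning step Q₁ s a k) x - Qbar x)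
        + (step k ^ 2 * (φ x.1 (s k) * M.policyResidual π (M.qLearning step Q₁ s a k) x)
          + (step (k + 1) - step k)
            * (φ x.1 (s (k + 1)) * M.policyResidual π (M.qLearning step Q₁ s a (k + 1)) x)
          + step k * (φ x.1 (s (k + 1)) * (M.policyResidual π (M.qLearning step Q₁ s a (k + 1)) x
            - M.policyResidual π (M.qLearning step Q₁ s a k) x))) := by
  simp only [correctedError]
  rw [M.averagedNoise_succ π φ step Q₁ s a hk, M.qLearning_succ step Q₁ s a hk x,
    M.tdIncrement_eq hφ]
  ring

section Bounds

variable {M}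

variable {π : Policy S A} {φ : S → S → ℝ} {Φ B : ℝ}

theorem abs_tdIncrement_le {Q : S × A → ℝ} (hQ : ∀ x, |Q x| ≤ B) (s : S) (a : A) (s' : S)
    (x : S × A) : |M.tdIncrement Q s a s' x| ≤ 1 + 2 * B := by
  have h1 := abs_le.1 (M.abs_reward_le s a)
  have h2 := abs_le.1 (abs_maxQ_le hQ s')
  have h3 := abs_le.1 (hQ (s, a))
  rw [tdIncrement, abs_le]
  split_ifs <;> constructor <;> linarith

theorem abs_martingaleNoise_le (hφ : ∀ t s, |φ t s| ≤ Φ) {Q : S × A → ℝ}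
    (hQ : ∀ x, |Q x| ≤ B) (s : S) (a : A) (s' : S) (x : S × A) :
    |M.martingaleNoise π φ Q s a s' x| ≤ (2 + 2 * Φ) * (1 + 2 * B) := by
  have h1 := M.abs_tdIncrement_le hQ s a s' x
  have h2 := abs_policyResidual_le (M := M) (π := π) hQ x
  have h3 : |(M.stateMatrix π *ᵥ φ x.1) s| ≤ Φ := stdSimplex_abs_sum_mul_le
    (row_mem_stdSimplex (M.stateMatrix_mem_rowStochastic π) s) (hφ x.1)
  have h4 : |φ x.1 s' - (M.stateMatrix π *ᵥ φ x.1) s| ≤ 2 * Φ :=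
    (abs_sub _ _).trans (by linarith [hφ x.1 s'])
  have h5 : |(if s = x.1 then 1 else 0) * M.policyResidual π Q x| ≤ 1 + 2 * B := by
    split_ifs
    · simpa using h2
    · simpa using (abs_nonneg _).trans h2
  have hB : 0 ≤ 1 + 2 * B := (abs_nonneg _).trans h2
  rw [martingaleNoise]
  calc _ ≤ |M.tdIncrement Q s a s' x| + |(if s = x.1 then 1 else 0) * M.policyResidual π Q x|
        + |M.policyResidual π Q x| * |φ x.1 s' - (M.stateMatrix π *ᵥ φ x.1) s| := by
        rw [← abs_mul]
        exact (abs_add_le _ _).trans (by gcongr; exact abs_sub _ _)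
    _ ≤ (1 + 2 * B) + (1 + 2 * B) + (1 + 2 * B) * (2 * Φ) := by gcongr
    _ = _ := by ring

end Bounds

end FiniteMDP

/-! ### Pathwise growth and contraction estimates -/

theorem sq_le_of_le_convex_combination {t t' w r : ℝ} (ht' : 0 ≤ t') (hr0 : 0 ≤ r) (hr1 : r ≤ 1)
    (h : t' ≤ (1 - r) * t + r * w) : t' ^ 2 ≤ (1 - r) * t ^ 2 + r * w ^ 2 := by
  have h1 : t' ^ 2 ≤ ((1 - r) * t + r * w) ^ 2 := by gcongr
  nlinarith [mul_nonneg (mul_nonneg hr0 (sub_nonneg.2 hr1)) (sq_nonneg (t - w))]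

namespace FiniteMDP

variable {S A : Type*} [Fintype S] [DecidableEq S] [Fintype A] [DecidableEq A] [Nonempty A]
  {M : FiniteMDP S A} {π : Policy S A} {μ : S → ℝ} {φ : S → S → ℝ} {Q₁ Qbar : S × A → ℝ}
  {s : ℕ → S} {a : ℕ → A} {α h : ℝ}

/-- The updated entry is a convex combination of an old entry and a reward plus an old maximum, so
only the reward can raise the bound. -/
theorem abs_qLearning_succ_le {step : ℕ → ℝ} {k : ℕ} (hk : 1 ≤ k) (h0 : 0 ≤ step k)
    (h1 : step k ≤ 1) {B : ℝ} (hB : ∀ x, |M.qLearning step Q₁ s a k x| ≤ B) (x : S × A) :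
    |M.qLearning step Q₁ s a (k + 1) x| ≤ B + step k := by
  rw [M.qLearning_succ step Q₁ s a hk, tdIncrement]
  have hx := hB x
  split_ifs with hsx
  · subst hsx
    have h2 := abs_le.1 (M.abs_reward_le (s k) (a k))
    have h3 := abs_le.1 (abs_maxQ_le hB (s (k + 1)))
    have h4 := abs_le.1 hx
    rw [abs_le]
    constructor <;> nlinarith
  · simp only [zero_mul, mul_zero, add_zero]
    linarith

theorem abs_qLearning_le (hα : 0 < α) (hαh : α ≤ h) (hh : 2 ≤ h) {B : ℝ} (hB0 : 0 ≤ B)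
    (hB : ∀ x, |Q₁ x| ≤ B) {k : ℕ} (hk : 1 ≤ k) :
    ∀ x, |M.qLearning (fun j => α / ((j : ℝ) + h)) Q₁ s a k x|
      ≤ (α + B / Real.log 2) * Real.log ((k : ℝ) + 1) := by
  have hlog2 : 0 < Real.log 2 := Real.log_pos one_lt_two
  induction k, hk using Nat.le_induction with
  | base =>
    intro x
    rw [qLearning, Nat.cast_one, one_add_one_eq_two, add_mul, div_mul_cancel₀ _ hlog2.ne']
    have := mul_pos hα hlog2
    linarith [hB x]
  | succ k hk ih =>
    intro x
    have hk0 : (0 : ℝ) ≤ k := Nat.cast_nonneg k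
    have hstep : α / ((k : ℝ) + h) ≤ 1 := by
      rw [div_le_one (by linarith)]
      linarith
    refine (abs_qLearning_succ_le hk (by positivity) hstep ih x).trans ?_
    -- Since `h ≥ 2`, the stepsize is dominated by `α` times an increment of the logarithm.
    have h1 := inv_le_log_succ_sub k
    have h2 : α / ((k : ℝ) + h) ≤ α * (1 / ((k : ℝ) + 2)) := by
      rw [mul_one_div]
      gcongr
    have h3 : α * (1 / ((k : ℝ) + 2)) ≤ (α + B / Real.log 2) *
        (Real.log (((k + 1 : ℕ) : ℝ) + 1) - Real.log ((k : ℝ) + 1)) := by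
      gcongr
      exact le_add_of_nonneg_right (by positivity)
    linarith

theorem one_add_two_mul_log_le {K : ℝ} {k : ℕ} (hk : 1 ≤ k) :
    1 + 2 * (K * Real.log ((k : ℝ) + 1)) ≤ (1 / Real.log 2 + 2 * K) * Real.log ((k : ℝ) + 1) := by
  have hlog2 : 0 < Real.log 2 := Real.log_pos one_lt_two
  have h1 := log_succ_mono hk
  rw [Nat.cast_one, one_add_one_eq_two] at h1
  have h2 : 1 ≤ 1 / Real.log 2 * Real.log ((k : ℝ) + 1) := by
    rw [one_div_mul_eq_div, le_div_iff₀ hlog2, one_mul]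
    exact h1
  linarith

theorem abs_policyResidual_qLearning_le {step : ℕ → ℝ} {K : ℝ} (hK : ∀ k : ℕ, 1 ≤ k → ∀ x,
    |M.qLearning step Q₁ s a k x| ≤ K * Real.log ((k : ℝ) + 1)) {k : ℕ} (hk : 1 ≤ k) (x : S × A) :
    |M.policyResidual π (M.qLearning step Q₁ s a k) x|
      ≤ (1 / Real.log 2 + 2 * K) * Real.log ((k : ℝ) + 1) :=
  (abs_policyResidual_le (hK k hk) x).trans (one_add_two_mul_log_le hk)

/-- The constant `5` is `1 + 2 + 2`, one summand per term: the second uses `log (k + 2) ≤ 2 * log (k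
+ 1)`, the third that the residual is `2`-Lipschitz in sup norm. -/
theorem abs_correctedError_remainder_le (hα : 1 ≤ α) (hh : 0 < h) {Φ K : ℝ} (hΦ : 0 ≤ Φ)
    (hK0 : 0 ≤ K) (hφΦ : ∀ t s, |φ t s| ≤ Φ) {step : ℕ → ℝ}
    (hstep : step = fun j : ℕ => α / ((j : ℝ) + h))
    (hK : ∀ k : ℕ, 1 ≤ k → ∀ x, |M.qLearning step Q₁ s a k x| ≤ K * Real.log ((k : ℝ) + 1))
    {k : ℕ} (hk : 1 ≤ k) (x : S × A) :
    |step k ^ 2 * (φ x.1 (s k) * M.policyResidual π (M.qLearning step Q₁ s a k) x)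
          + (step (k + 1) - step k)
            * (φ x.1 (s (k + 1)) * M.policyResidual π (M.qLearning step Q₁ s a (k + 1)) x)
          + step k * (φ x.1 (s (k + 1)) * (M.policyResidual π (M.qLearning step Q₁ s a (k + 1)) x
            - M.policyResidual π (M.qLearning step Q₁ s a k) x))|
      ≤ 5 * Φ * (1 / Real.log 2 + 2 * K) * step k ^ 2 * Real.log ((k : ℝ) + 1) := by
  have hlog2 : 0 < Real.log 2 := Real.log_pos one_lt_two
  have hL := log_succ_pos hk
  have hk0 : (0 : ℝ) ≤ k := Nat.cast_nonneg k
  set N := 1 / Real.log 2 + 2 * K with hN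
  have hN0 : 0 ≤ N := by positivity
  have hs0 : 0 ≤ step k := by rw [hstep]; positivity
  have h1 := abs_policyResidual_qLearning_le (π := π) hK hk x
  have h2 : |M.policyResidual π (M.qLearning step Q₁ s a (k + 1)) x|
      ≤ N * (2 * Real.log ((k : ℝ) + 1)) :=
    (abs_policyResidual_qLearning_le (π := π) hK (by omega) x).trans
      (by gcongr; exact log_succ_succ_le hk)
  have h3 : |M.policyResidual π (M.qLearning step Q₁ s a (k + 1)) x
      - M.policyResidual π (M.qLearning step Q₁ s a k) x|
      ≤ 2 * (step k * (N * Real.log ((k : ℝ) + 1))) := by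
    refine abs_policyResidual_sub_le (fun x => ?_) x
    rw [M.qLearning_succ step Q₁ s a hk, add_sub_cancel_left, abs_mul, abs_of_nonneg hs0]
    gcongr
    exact (abs_tdIncrement_le (hK k hk) _ _ _ x).trans (one_add_two_mul_log_le hk)
  -- The difference is `α / (t * (t + 1))` with `t = k + h`; it is below `α ^ 2 / t ^ 2` because `α
  -- ≥ 1`.
  have h4 : |step (k + 1) - step k| ≤ step k ^ 2 := by
    rw [abs_sub_comm, hstep]
    have hle : α / (((k + 1 : ℕ) : ℝ) + h) ≤ α / ((k : ℝ) + h) := by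
      gcongr
      omega
    rw [abs_of_nonneg (sub_nonneg.2 hle)]
    push_cast
    rw [div_sub_div _ _ (by positivity) (by positivity), div_pow,
      div_le_div_iff₀ (by positivity) (by positivity)]
    have ht : 0 < (k : ℝ) + h := by positivity
    set t := (k : ℝ) + h
    have : (k : ℝ) + 1 + h = t + 1 := by ring
    rw [this]
    have e : (α * (t + 1) - t * α) * t ^ 2 = t ^ 2 * α := by ring
    rw [e]
    have h5 : t ^ 2 * α ≤ (t * (t + 1)) * α := by gcongr; nlinarith
    nlinarith [mul_nonneg (mul_nonneg (mul_nonneg ht.le (by linarith : 0 ≤ t + 1))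
      (by linarith : 0 ≤ α)) (sub_nonneg.2 hα)]
  refine (abs_add_three _ _ _).trans ?_
  simp only [abs_mul, abs_of_nonneg hs0, abs_of_nonneg (sq_nonneg (step k))]
  calc _ ≤ step k ^ 2 * (Φ * (N * Real.log ((k : ℝ) + 1)))
        + step k ^ 2 * (Φ * (N * (2 * Real.log ((k : ℝ) + 1))))
        + step k * (Φ * (2 * (step k * (N * Real.log ((k : ℝ) + 1))))) := by
        gcongr <;> apply hφΦ
    _ = _ := by ring

theorem spanSeminorm_smul_correction_le [Nonempty S] {Φ K : ℝ} (hΦ : 0 ≤ Φ)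
    (hφΦ : ∀ t s, |φ t s| ≤ Φ) {step : ℕ → ℝ}
    (hK : ∀ k : ℕ, 1 ≤ k → ∀ x, |M.qLearning step Q₁ s a k x| ≤ K * Real.log ((k : ℝ) + 1))
    {k : ℕ} (hs0 : 0 ≤ step k) (hk : 1 ≤ k) :
    spanSeminorm (fun x : S × A =>
        step k * (φ x.1 (s k) * M.policyResidual π (M.qLearning step Q₁ s a k) x))
      ≤ Φ * (1 / Real.log 2 + 2 * K) * step k * Real.log ((k : ℝ) + 1) := by
  refine spanSeminorm_le_of_abs_le fun x => ?_
  rw [abs_mul, abs_mul, abs_of_nonneg hs0]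
  calc _ ≤ step k * (Φ * ((1 / Real.log 2 + 2 * K) * Real.log ((k : ℝ) + 1))) := by
        gcongr
        · apply hφΦ
        · exact abs_policyResidual_qLearning_le hK hk x
    _ = _ := by ring

theorem qLearning_sub_eq (step : ℕ → ℝ) (k : ℕ) :
    M.qLearning step Q₁ s a k - Qbar = M.correctedError π φ step Q₁ Qbar s a k
      + M.averagedNoise π φ step Q₁ s a k - fun x : S × A =>
        step k * (φ x.1 (s k) * M.policyResidual π (M.qLearning step Q₁ s a k) x) := by
  ext x
  simp only [correctedError, Pi.add_apply, Pi.sub_apply]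
  ring

theorem spanSeminorm_qLearning_sub_le [Nonempty S] {Φ K : ℝ} (hΦ : 0 ≤ Φ)
    (hφΦ : ∀ t s, |φ t s| ≤ Φ) {step : ℕ → ℝ}
    (hK : ∀ k : ℕ, 1 ≤ k → ∀ x, |M.qLearning step Q₁ s a k x| ≤ K * Real.log ((k : ℝ) + 1))
    {k : ℕ} (hs0 : 0 ≤ step k) (hk : 1 ≤ k) :
    spanSeminorm (M.qLearning step Q₁ s a k - Qbar)
      ≤ spanSeminorm (M.correctedError π φ step Q₁ Qbar s a k)
        + spanSeminorm (M.averagedNoise π φ step Q₁ s a k)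
        + Φ * (1 / Real.log 2 + 2 * K) * step k * Real.log ((k : ℝ) + 1) := by
  rw [qLearning_sub_eq (M := M) (π := π) (φ := φ)]
  refine (spanSeminorm_sub_le _ _).trans (add_le_add (spanSeminorm_add_le _ _) ?_)
  exact spanSeminorm_smul_correction_le hΦ hφΦ hK hs0 hk

/-- The contraction is applied to the iterate itself, which differs from the corrected error by the
averaged noise and the boundary term. The constant `6` is the remainder's `5` plus one for that
boundary term. -/
theorem spanSeminorm_correctedError_succ_le [Nonempty S]
    (hφ : ∀ t s, φ t s - (M.stateMatrix π *ᵥ φ t) s = (if s = t then 1 else 0) - μ t)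
    {b : ℝ} (hb0 : 0 ≤ b) (hb1 : b < 1) (hb : ∀ Q₁ Q₂ : S × A → ℝ,
      spanSeminorm (M.asyncBellman π μ Q₁ - M.asyncBellman π μ Q₂) ≤ b * spanSeminorm (Q₁ - Q₂))
    (hQbar : spanSeminorm (M.asyncBellman π μ Qbar - Qbar) = 0) (hα : 1 ≤ α) (hαh : α ≤ h)
    {Φ K : ℝ} (hΦ : 0 ≤ Φ) (hK0 : 0 ≤ K) (hφΦ : ∀ t s, |φ t s| ≤ Φ) {step : ℕ → ℝ}
    (hstep : step = fun j : ℕ => α / ((j : ℝ) + h))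
    (hK : ∀ k : ℕ, 1 ≤ k → ∀ x, |M.qLearning step Q₁ s a k x| ≤ K * Real.log ((k : ℝ) + 1))
    {k : ℕ} (hk : 1 ≤ k) :
    spanSeminorm (M.correctedError π φ step Q₁ Qbar s a (k + 1))
      ≤ (1 - (1 - b) * step k) * spanSeminorm (M.correctedError π φ step Q₁ Qbar s a k)
        + step k * (spanSeminorm (M.averagedNoise π φ step Q₁ s a k)
          + 6 * Φ * (1 / Real.log 2 + 2 * K) * step k * Real.log ((k : ℝ) + 1)) := by
  have hlog2 : 0 < Real.log 2 := Real.log_pos one_lt_two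
  have hL := log_succ_pos hk
  have hk0 : (0 : ℝ) ≤ k := Nat.cast_nonneg k
  have hs0 : 0 ≤ step k := by
    rw [hstep]
    exact div_nonneg (by linarith) (by linarith)
  have hs1 : step k ≤ 1 := by
    rw [hstep, div_le_one (by linarith)]
    linarith
  set q := M.correctedError π φ step Q₁ Qbar s a k
  set v := M.averagedNoise π φ step Q₁ s a k
  set E := Φ * (1 / Real.log 2 + 2 * K) * step k * Real.log ((k : ℝ) + 1) with hE
  have hE0 : 0 ≤ E := by positivity
  have hrem := spanSeminorm_le_of_abs_le
    (abs_correctedError_remainder_le (π := π) hα (by linarith) hΦ hK0 hφΦ hstep hK hk)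
  have hdecomp : M.correctedError π φ step Q₁ Qbar s a (k + 1) = (1 - step k) • q
      + step k • (M.asyncBellman π μ (M.qLearning step Q₁ s a k) - Qbar) + _ :=
    funext (M.correctedError_succ hφ step Q₁ Qbar s a hk)
  have hH : spanSeminorm (M.asyncBellman π μ (M.qLearning step Q₁ s a k) - Qbar)
      ≤ b * (spanSeminorm q + spanSeminorm v + E) := by
    rw [← sub_add_sub_cancel _ (M.asyncBellman π μ Qbar)]
    refine (spanSeminorm_add_le _ _).trans ?_
    rw [hQbar, add_zero]
    refine (hb _ _).trans ?_
    gcongr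
    exact spanSeminorm_qLearning_sub_le hΦ hφΦ hK hs0 hk
  rw [hdecomp]
  have hv := spanSeminorm_nonneg v
  calc _ ≤ (1 - step k) * spanSeminorm q + step k * (b * (spanSeminorm q + spanSeminorm v + E))
        + 5 * Φ * (1 / Real.log 2 + 2 * K) * step k ^ 2 * Real.log ((k : ℝ) + 1) := by
        refine (spanSeminorm_add_le _ _).trans (add_le_add ?_ hrem)
        refine (spanSeminorm_add_le _ _).trans (add_le_add ?_ ?_)
        · exact spanSeminorm_smul_le (by linarith) _
        · exact (spanSeminorm_smul_le hs0 _).trans (by gcongr)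
    _ = (1 - (1 - b) * step k) * spanSeminorm q + step k * (b * (spanSeminorm v + E))
        + step k * (5 * E) := by rw [hE]; ring
    _ ≤ (1 - (1 - b) * step k) * spanSeminorm q + step k * (1 * (spanSeminorm v + E))
        + step k * (5 * E) := by gcongr
    _ = _ := by rw [hE]; ring

theorem spanSeminorm_correctedError_succ_sq_le [Nonempty S]
    (hφ : ∀ t s, φ t s - (M.stateMatrix π *ᵥ φ t) s = (if s = t then 1 else 0) - μ t)
    {b : ℝ} (hb0 : 0 ≤ b) (hb1 : b < 1) (hb : ∀ Q₁ Q₂ : S × A → ℝ,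
      spanSeminorm (M.asyncBellman π μ Q₁ - M.asyncBellman π μ Q₂) ≤ b * spanSeminorm (Q₁ - Q₂))
    (hQbar : spanSeminorm (M.asyncBellman π μ Qbar - Qbar) = 0) (hα : 1 ≤ α) (hαh : α ≤ h)
    {Φ K : ℝ} (hΦ : 0 ≤ Φ) (hK0 : 0 ≤ K) (hφΦ : ∀ t s, |φ t s| ≤ Φ) {step : ℕ → ℝ}
    (hstep : step = fun j : ℕ => α / ((j : ℝ) + h))
    (hK : ∀ k : ℕ, 1 ≤ k → ∀ x, |M.qLearning step Q₁ s a k x| ≤ K * Real.log ((k : ℝ) + 1))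
    {k : ℕ} (hk : 1 ≤ k) :
    spanSeminorm (M.correctedError π φ step Q₁ Qbar s a (k + 1)) ^ 2
      ≤ (1 - (1 - b) * step k) * spanSeminorm (M.correctedError π φ step Q₁ Qbar s a k) ^ 2
        + 2 / (1 - b) * step k * (spanSeminorm (M.averagedNoise π φ step Q₁ s a k) ^ 2
          + (6 * Φ * (1 / Real.log 2 + 2 * K) * step k * Real.log ((k : ℝ) + 1)) ^ 2) := by
  have hk0 : (0 : ℝ) ≤ k := Nat.cast_nonneg k
  have hs0 : 0 ≤ step k := by
    rw [hstep]
    exact div_nonneg (by linarith) (by linarith)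
  have hs1 : step k ≤ 1 := by
    rw [hstep, div_le_one (by linarith)]
    linarith
  have hc : 0 < 1 - b := by linarith
  have h1 := spanSeminorm_correctedError_succ_le hφ hb0 hb1 hb hQbar hα hαh hΦ hK0 hφΦ hstep hK hk
  set v := spanSeminorm (M.averagedNoise π φ step Q₁ s a k)
  set E := 6 * Φ * (1 / Real.log 2 + 2 * K) * step k * Real.log ((k : ℝ) + 1)
  -- Reading the bound as a convex combination with weight `(1 - b) * step k` squares it without
  -- losing any of the contraction rate.
  have h2 := sq_le_of_le_convex_combination
    (t := spanSeminorm (M.correctedError π φ step Q₁ Qbar s a k)) (w := (v + E) / (1 - b))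
    (spanSeminorm_nonneg _)
    (by positivity : 0 ≤ (1 - b) * step k) (by nlinarith) (h1.trans_eq (by field_simp))
  refine h2.trans (add_le_add le_rfl ?_)
  calc (1 - b) * step k * ((v + E) / (1 - b)) ^ 2 = step k / (1 - b) * (v + E) ^ 2 := by
        field_simp
    _ ≤ step k / (1 - b) * (2 * (v ^ 2 + E ^ 2)) := by gcongr; exact add_sq_le
    _ = _ := by ring

end FiniteMDP

/-! ### Integrals of functions of finite histories -/

section FiniteRange

variable {Ω T : Type*} [MeasurableSpace Ω] {ℙ : Measure Ω} [IsFiniteMeasure ℙ] [Fintype T]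
  {X : Ω → T}

theorem integrable_comp_of_fintype (hX : ∀ t, MeasurableSet {ω | X ω = t}) (g : T → ℝ) :
    Integrable (fun ω => g (X ω)) ℙ := by
  let _ : MeasurableSpace T := ⊤
  have hXm : Measurable X := measurable_to_countable' hX
  exact (Integrable.of_finite (μ := ℙ.map X) (f := g)).comp_measurable hXm

theorem integral_comp_eq_sum (hX : ∀ t, MeasurableSet {ω | X ω = t}) (g : T → ℝ) :
    ∫ ω, g (X ω) ∂ℙ = ∑ t, ℙ.real {ω | X ω = t} * g t := by
  let _ : MeasurableSpace T := ⊤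
  have hXm : Measurable X := measurable_to_countable' hX
  rw [← integral_map hXm.aemeasurable (by fun_prop), integral_fintype Integrable.of_finite]
  refine Finset.sum_congr rfl fun t _ => ?_
  rw [map_measureReal_apply hXm (measurableSet_singleton t), smul_eq_mul]
  rfl

end FiniteRange

namespace FiniteMDP

/-- A function of a path `(s, a)` that depends on `s_1, …, s_k` and `a_1, …, a_{k-1}` only. -/
def DependsOnPast {S A X : Type*} (k : ℕ) (F : (ℕ → S) → (ℕ → A) → X) : Prop :=
  ∀ (s s' : ℕ → S) (a a' : ℕ → A), (∀ i ∈ Finset.Icc 1 k, s i = s' i) →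
    (∀ i ∈ Finset.Ico 1 k, a i = a' i) → F s a = F s' a'

/-- The states up to time `k` and the actions before time `k`. -/
abbrev History (S A : Type*) (k : ℕ) : Type _ :=
  (Finset.Icc 1 k → S) × (Finset.Ico 1 k → A)

namespace History

variable {S A : Type*} {k : ℕ}

/-- The history of a path. -/
def ofPath (k : ℕ) (s : ℕ → S) (a : ℕ → A) : History S A k := (fun i => s i, fun i => a i)

/-- The states of a path with a given history, constant afterwards. -/
def extendState (η : History S A k) (t : S) (i : ℕ) : S :=
  if hi : i ∈ Finset.Icc 1 k then η.1 ⟨i, hi⟩ else t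

/-- The actions of a path with a given history, constant afterwards. -/
def extendAction (η : History S A k) (b : A) (i : ℕ) : A :=
  if hi : i ∈ Finset.Ico 1 k then η.2 ⟨i, hi⟩ else b

theorem ofPath_eq_iff {s : ℕ → S} {a : ℕ → A} {η : History S A k} (t : S) (b : A) :
    ofPath k s a = η ↔ (∀ i ∈ Finset.Icc 1 k, s i = η.extendState t i) ∧
      ∀ i ∈ Finset.Ico 1 k, a i = η.extendAction b i := by
  rw [Prod.ext_iff, funext_iff, funext_iff, Subtype.forall, Subtype.forall]
  refine and_congr (forall₂_congr fun i hi => ?_) (forall₂_congr fun i hi => ?_)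
  · rw [extendState, dif_pos hi]; rfl
  · rw [extendAction, dif_pos hi]; rfl

theorem extendState_succ (η : History S A k) (t : S) : η.extendState t (k + 1) = t :=
  dif_neg (by simp)

theorem extendAction_self (η : History S A k) (b : A) : η.extendAction b k = b :=
  dif_neg (by simp)

end History

namespace DependsOnPast

variable {S A X : Type*} {k : ℕ} {F : (ℕ → S) → (ℕ → A) → X}

theorem mono {l : ℕ} (hF : DependsOnPast k F) (hkl : k ≤ l) : DependsOnPast l F :=
  fun s s' a a' hs ha => hF s s' a a'
    (fun i hi => hs i (Finset.Icc_subset_Icc_right hkl hi))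
    (fun i hi => ha i (Finset.Ico_subset_Ico_right hkl hi))

theorem comp {Y : Type*} (g : X → Y) (hF : DependsOnPast k F) :
    DependsOnPast k fun s a => g (F s a) :=
  fun s s' a a' hs ha => congrArg g (hF s s' a a' hs ha)

theorem comp₂ {Y Z : Type*} {G : (ℕ → S) → (ℕ → A) → Y} (g : X → Y → Z) (hF : DependsOnPast k F)
    (hG : DependsOnPast k G) : DependsOnPast k fun s a => g (F s a) (G s a) :=
  fun s s' a a' hs ha => congrArg₂ g (hF s s' a a' hs ha) (hG s s' a a' hs ha)

/-- Such a function factors through the finite type `History`, which settles measurability and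
integrability at once. -/
theorem eq_extend (hF : DependsOnPast k F) (s : ℕ → S) (a : ℕ → A) (t : S) (b : A) :
    F s a = F ((History.ofPath k s a).extendState t) ((History.ofPath k s a).extendAction b) := by
  have h := (History.ofPath_eq_iff (s := s) (a := a) (k := k) t b).1 rfl
  exact hF _ _ _ _ h.1 h.2

end DependsOnPast

theorem dependsOnPast_state {S A : Type*} {k l : ℕ} (hl : 1 ≤ l) (hlk : l ≤ k) :
    DependsOnPast k fun (s : ℕ → S) (_ : ℕ → A) => s l :=
  fun _ _ _ _ hs _ => hs l (Finset.mem_Icc.2 ⟨hl, hlk⟩)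

theorem dependsOnPast_action {S A : Type*} {k l : ℕ} (hl : 1 ≤ l) (hlk : l < k) :
    DependsOnPast k fun (_ : ℕ → S) (a : ℕ → A) => a l :=
  fun _ _ _ _ _ ha => ha l (Finset.mem_Ico.2 ⟨hl, hlk⟩)

section Trajectory

variable {S A : Type*} [Fintype S] [Fintype A] {M : FiniteMDP S A}
  {π : Policy S A} {s₁ : S} {Ω : Type*} [MeasurableSpace Ω] {ℙ : Measure Ω} {St : ℕ → Ω → S}
  {Ac : ℕ → Ω → A}

/-- The action law followed by the state law, with the filler values of the extended path chosen to
be the action `b` and the next state `t`. -/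
theorem IsTrajectory.real_history (hT : M.IsTrajectory π s₁ ℙ St Ac) {k : ℕ} (hk : 1 ≤ k)
    (η : History S A k) (b : A) (t : S) :
    ℙ.real {ω | (History.ofPath k (fun i => St i ω) (fun i => Ac i ω), Ac k ω, St (k + 1) ω)
        = (η, b, t)}
      = M.trans (η.extendState t k) b t * (π.prob (η.extendState t k) b *
        ℙ.real {ω | History.ofPath k (fun i => St i ω) (fun i => Ac i ω) = η}) := by
  have h1 := hT.state_law k hk (η.extendState t) (η.extendAction b)
  have h2 := hT.action_law k hk (η.extendState t) (η.extendAction b)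
  rw [η.extendState_succ, η.extendAction_self] at h1
  rw [η.extendAction_self] at h2
  have hI : ∀ p : ℕ → Prop, (∀ i ∈ Finset.Icc 1 k, p i) ↔ (∀ i ∈ Finset.Ico 1 k, p i) ∧ p k := by
    intro p
    rw [← Finset.Ico_insert_right hk, Finset.forall_mem_insert]
    exact and_comm
  convert h1 using 2
  · ext ω
    simp only [Set.mem_ofPred_eq, Prod.mk.injEq, History.ofPath_eq_iff t b, hI,
      η.extendAction_self]
    grind
  · convert h2.symm using 2
    · congr 1
      ext ω
      simp only [Set.mem_ofPred_eq, History.ofPath_eq_iff t b, hI]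
      grind
    · simp only [hI, η.extendAction_self]

variable [Nonempty S] [Nonempty A]

theorem IsTrajectory.measurableSet_history (hT : M.IsTrajectory π s₁ ℙ St Ac) (k : ℕ)
    (η : History S A k) :
    MeasurableSet {ω | History.ofPath k (fun i => St i ω) (fun i => Ac i ω) = η} := by
  let t := Classical.arbitrary S
  let b := Classical.arbitrary A
  have : {ω | History.ofPath k (fun i => St i ω) (fun i => Ac i ω) = η}
      = (⋂ i ∈ Finset.Icc 1 k, {ω | St i ω = η.extendState t i})
        ∩ ⋂ i ∈ Finset.Ico 1 k, {ω | Ac i ω = η.extendAction b i} := by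
    ext ω
    simp only [Set.mem_ofPred_eq, Set.mem_inter_iff, Set.mem_iInter, History.ofPath_eq_iff t b]
  rw [this]
  exact (Finset.measurableSet_biInter _ fun i _ => hT.measurable_state i _).inter
    (Finset.measurableSet_biInter _ fun i _ => hT.measurable_action i _)

variable [IsFiniteMeasure ℙ]

theorem IsTrajectory.integrable (hT : M.IsTrajectory π s₁ ℙ St Ac) {k : ℕ}
    {F : (ℕ → S) → (ℕ → A) → ℝ} (hF : DependsOnPast k F) :
    Integrable (fun ω => F (fun i => St i ω) fun i => Ac i ω) ℙ := by
  rw [funext fun ω => hF.eq_extend _ _ (Classical.arbitrary S) (Classical.arbitrary A)]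
  exact integrable_comp_of_fintype
    (X := fun ω => History.ofPath k (fun i => St i ω) (fun i => Ac i ω))
    (hT.measurableSet_history k)
    (fun η => F (η.extendState (Classical.arbitrary S)) (η.extendAction (Classical.arbitrary A)))

/-- The integral of a function of the history at time `k`, the action and the next state vanishes
if its conditional expectation given the history does. -/
theorem IsTrajectory.integral_eq_zero (hT : M.IsTrajectory π s₁ ℙ St Ac) {k : ℕ} (hk : 1 ≤ k)
    {G : (ℕ → S) → (ℕ → A) → A → S → ℝ} (hG : DependsOnPast k G)
    (h0 : ∀ s a, ∑ b, π.prob (s k) b * ∑ t, M.trans (s k) b t * G s a b t = 0) :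
    ∫ ω, G (fun i => St i ω) (fun i => Ac i ω) (Ac k ω) (St (k + 1) ω) ∂ℙ = 0 := by
  let t₀ := Classical.arbitrary S
  let b₀ := Classical.arbitrary A
  rw [funext fun ω => congrFun₂ (hG.eq_extend _ _ t₀ b₀) (Ac k ω) (St (k + 1) ω)]
  have hmeas : ∀ y : History S A k × A × S, MeasurableSet
      {ω | (History.ofPath k (fun i => St i ω) (fun i => Ac i ω), Ac k ω, St (k + 1) ω) = y} := by
    rintro ⟨η, b, t⟩
    simp only [Prod.mk.injEq]
    exact (hT.measurableSet_history k η).inter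
      ((hT.measurable_action k b).inter (hT.measurable_state (k + 1) t))
  rw [integral_comp_eq_sum hmeas
    (fun y => G (y.1.extendState t₀) (y.1.extendAction b₀) y.2.1 y.2.2)]
  rw [Fintype.sum_prod_type]
  refine Finset.sum_eq_zero fun η _ => ?_
  rw [Fintype.sum_prod_type]
  have hk' : k ∈ Finset.Icc 1 k := Finset.mem_Icc.2 ⟨hk, le_rfl⟩
  -- The state at time `k` belongs to the history, so the filler does not affect it.
  have hst : ∀ t, η.extendState t k = η.extendState t₀ k := fun t => by
    simp only [History.extendState, dif_pos hk']
  simp only [hT.real_history hk, hst]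
  rw [← mul_zero (ℙ.real {ω | History.ofPath k (fun i => St i ω) (fun i => Ac i ω) = η}),
    ← h0 (η.extendState t₀) (η.extendAction b₀), Finset.mul_sum]
  refine Finset.sum_congr rfl fun b _ => ?_
  rw [Finset.mul_sum, Finset.mul_sum]
  exact Finset.sum_congr rfl fun t _ => by ring

end Trajectory

variable {S A : Type*} [Fintype S] [DecidableEq S] [Fintype A] [DecidableEq A] [Nonempty A]

theorem dependsOnPast_qLearning (M : FiniteMDP S A) (step : ℕ → ℝ) (Q₁ : S × A → ℝ) {k : ℕ}
    (hk : 1 ≤ k) : DependsOnPast k fun s a => M.qLearning step Q₁ s a k := by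
  induction k, hk using Nat.le_induction with
  | base => exact fun _ _ _ _ _ _ => rfl
  | succ k hk ih =>
    intro s s' a a' hs ha
    have h1 := ih.mono k.le_succ s s' a a' hs ha
    have h2 := dependsOnPast_state hk k.le_succ s s' a a' hs ha
    have h3 := dependsOnPast_state (Nat.le_add_left 1 k) le_rfl s s' a a' hs ha
    have h4 := dependsOnPast_action hk k.lt_succ_self s s' a a' hs ha
    ext x
    simp only at h1 h2 h3 h4 ⊢
    rw [M.qLearning_succ _ _ _ _ hk, M.qLearning_succ _ _ _ _ hk, h1, h2, h3, h4]

theorem dependsOnPast_averagedNoise (M : FiniteMDP S A) (π : Policy S A) (φ : S → S → ℝ)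
    (step : ℕ → ℝ) (Q₁ : S × A → ℝ) {k : ℕ} (hk : 1 ≤ k) :
    DependsOnPast k fun s a => M.averagedNoise π φ step Q₁ s a k := by
  induction k, hk using Nat.le_induction with
  | base => exact fun _ _ _ _ _ _ => rfl
  | succ k hk ih =>
    intro s s' a a' hs ha
    have h0 := ih.mono k.le_succ s s' a a' hs ha
    have h1 := (dependsOnPast_qLearning M step Q₁ hk).mono k.le_succ s s' a a' hs ha
    have h2 := dependsOnPast_state hk k.le_succ s s' a a' hs ha
    have h3 := dependsOnPast_state (Nat.le_add_left 1 k) le_rfl s s' a a' hs ha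
    have h4 := dependsOnPast_action hk k.lt_succ_self s s' a a' hs ha
    ext x
    simp only at h0 h1 h2 h3 h4 ⊢
    rw [M.averagedNoise_succ _ _ _ _ _ _ hk, M.averagedNoise_succ _ _ _ _ _ _ hk,
      h0, h1, h2, h3, h4]

theorem dependsOnPast_correctedError (M : FiniteMDP S A) (π : Policy S A) (φ : S → S → ℝ)
    (step : ℕ → ℝ) (Q₁ Qbar : S × A → ℝ) {k : ℕ} (hk : 1 ≤ k) :
    DependsOnPast k fun s a => M.correctedError π φ step Q₁ Qbar s a k := by
  intro s s' a a' hs ha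
  have h0 := dependsOnPast_averagedNoise M π φ step Q₁ hk s s' a a' hs ha
  have h1 := dependsOnPast_qLearning M step Q₁ hk s s' a a' hs ha
  have h2 := dependsOnPast_state hk le_rfl s s' a a' hs ha
  ext x
  simp only at h0 h1 h2 ⊢
  rw [correctedError, correctedError, h0, h1, h2]

/-! ### Second moments of the noise and of the error -/

section MeanSquare

variable [Nonempty S] {M : FiniteMDP S A} {π : Policy S A} {μ : S → ℝ} {φ : S → S → ℝ}
  {Q₁ Qbar : S × A → ℝ} {α h Φ K : ℝ} {step : ℕ → ℝ} {s₁ : S} {Ω : Type*} [MeasurableSpace Ω]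
  {ℙ : Measure Ω} [IsProbabilityMeasure ℙ] {St : ℕ → Ω → S} {Ac : ℕ → Ω → A}

/-- The cross term integrates to zero because the average is determined by the past and the new
noise is conditionally centered; then `(1 - step k) ^ 2 ≤ 1 - step k`. -/
theorem IsTrajectory.integral_averagedNoise_sq_succ_le (hT : M.IsTrajectory π s₁ ℙ St Ac) {k : ℕ}
    (hk : 1 ≤ k) (hs0 : 0 ≤ step k) (hs1 : step k ≤ 1) {B : ℝ}
    (hB : ∀ s a b t x, |M.martingaleNoise π φ (M.qLearning step Q₁ s a k) (s k) b t x| ≤ B)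
    (x : S × A) :
    ∫ ω, M.averagedNoise π φ step Q₁ (fun i => St i ω) (fun i => Ac i ω) (k + 1) x ^ 2 ∂ℙ
      ≤ (1 - step k) *
        ∫ ω, M.averagedNoise π φ step Q₁ (fun i => St i ω) (fun i => Ac i ω) k x ^ 2 ∂ℙ
        + step k ^ 2 * B ^ 2 := by
  set v : (ℕ → S) → (ℕ → A) → ℝ := fun s a => M.averagedNoise π φ step Q₁ s a k x
  set m : (ℕ → S) → (ℕ → A) → A → S → ℝ := fun s a b t =>
    M.martingaleNoise π φ (M.qLearning step Q₁ s a k) (s k) b t x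
  have hv : DependsOnPast k v := (dependsOnPast_averagedNoise M π φ step Q₁ hk).comp fun f => f x
  have hm : DependsOnPast k m :=
    (dependsOnPast_qLearning M step Q₁ hk).comp₂ (fun Q s b t => M.martingaleNoise π φ Q s b t x)
      (dependsOnPast_state hk le_rfl)
  have hzero := hT.integral_eq_zero hk (G := fun s a b t => v s a * m s a b t)
    (hv.comp₂ (fun c f b t => c * f b t) hm) fun s a => by
      have := M.sum_martingaleNoise π φ (M.qLearning step Q₁ s a k) (s k) x
      rw [← mul_zero (v s a), ← this]
      simp only [Finset.mul_sum, m]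
      exact Finset.sum_congr rfl fun b _ => Finset.sum_congr rfl fun t _ => by ring
  have hmv : DependsOnPast (k + 1) fun s a => v s a * m s a (a k) (s (k + 1)) := by
    intro s s' a a' hs ha
    have h1 := hv.mono k.le_succ s s' a a' hs ha
    have h2 := hm.mono k.le_succ s s' a a' hs ha
    have h3 := dependsOnPast_state (Nat.le_add_left 1 k) le_rfl s s' a a' hs ha
    have h4 := dependsOnPast_action hk k.lt_succ_self s s' a a' hs ha
    simp only at h3 h4 ⊢
    rw [h1, h2, h3, h4]
  have h1 : Integrable (fun ω => (1 - step k) * v (fun i => St i ω) (fun i => Ac i ω) ^ 2) ℙ :=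
    (hT.integrable (hv.comp fun c => c ^ 2)).const_mul _
  have h2 : Integrable (fun ω => 2 * (1 - step k) * step k * (v (fun i => St i ω)
      (fun i => Ac i ω) * m (fun i => St i ω) (fun i => Ac i ω) (Ac k ω) (St (k + 1) ω))) ℙ :=
    (hT.integrable hmv).const_mul _
  have h12 : Integrable (fun ω => (1 - step k) * v (fun i => St i ω) (fun i => Ac i ω) ^ 2
      + 2 * (1 - step k) * step k * (v (fun i => St i ω) (fun i => Ac i ω)
        * m (fun i => St i ω) (fun i => Ac i ω) (Ac k ω) (St (k + 1) ω))) ℙ := h1.add h2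
  calc _ ≤ ∫ ω, ((1 - step k) * v (fun i => St i ω) (fun i => Ac i ω) ^ 2
        + 2 * (1 - step k) * step k * (v (fun i => St i ω) (fun i => Ac i ω)
          * m (fun i => St i ω) (fun i => Ac i ω) (Ac k ω) (St (k + 1) ω))
        + step k ^ 2 * B ^ 2) ∂ℙ := by
        refine integral_mono
          (hT.integrable (((dependsOnPast_averagedNoise M π φ step Q₁
            (Nat.le_add_left 1 k)).comp fun f => f x).comp fun c => c ^ 2))
          (h12.add (integrable_const _)) fun ω => ?_
        simp only [M.averagedNoise_succ _ _ _ _ _ _ hk]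
        have h1 := abs_le.1 (hB (fun i => St i ω) (fun i => Ac i ω) (Ac k ω) (St (k + 1) ω) x)
        have h2 := sq_le_sq' h1.1 h1.2
        have h3 := mul_le_mul_of_nonneg_left h2 (sq_nonneg (step k))
        have h4 : (1 - step k) ^ 2 * v (fun i => St i ω) (fun i => Ac i ω) ^ 2
            ≤ (1 - step k) * v (fun i => St i ω) (fun i => Ac i ω) ^ 2 := by
          gcongr
          nlinarith
        simp only [v, m] at h3 h4 ⊢
        linarith
    _ = _ := by
        rw [integral_add h12 (integrable_const _), integral_add h1 h2, integral_const_mul,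
          integral_const_mul, hzero]
        simp [v]

theorem IsTrajectory.integral_averagedNoise_sq_le (hT : M.IsTrajectory π s₁ ℙ St Ac)
    (hα : 2 ≤ α) (hαh : α ≤ h) (hΦ : 0 ≤ Φ) (hφΦ : ∀ t s, |φ t s| ≤ Φ)
    (hstep : step = fun j : ℕ => α / ((j : ℝ) + h))
    (hK : ∀ s a (k : ℕ), 1 ≤ k → ∀ x, |M.qLearning step Q₁ s a k x| ≤ K * Real.log ((k : ℝ) + 1))
    {k : ℕ} (hk : 1 ≤ k) (x : S × A) :
    ∫ ω, M.averagedNoise π φ step Q₁ (fun i => St i ω) (fun i => Ac i ω) k x ^ 2 ∂ℙ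
      ≤ ((2 + 2 * Φ) * (1 / Real.log 2 + 2 * K)) ^ 2 * α ^ 2 * Real.log ((k : ℝ) + 1) ^ 2
        / (k + h) := by
  refine le_div_of_stepsize_recursion (c := 1)
    (A := fun k => ∫ ω, M.averagedNoise π φ step Q₁ (fun i => St i ω) (fun i => Ac i ω) k x ^ 2 ∂ℙ)
    (Λ := fun k => Real.log ((k : ℝ) + 1) ^ 2) (fun k _ => sq_nonneg _) (fun k hk => ?_)
    (by linarith) (by linarith : 2 ≤ 1 * α) (by linarith) le_rfl (by positivity) ?_ (fun k hk => ?_)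
    hk
  · gcongr
    · exact (log_succ_pos hk).le
    · exact k.le_succ
  · simp only [averagedNoise, Pi.zero_apply, ne_eq, OfNat.ofNat_ne_zero, not_false_eq_true,
      zero_pow, integral_zero]
    exact div_nonneg (by positivity) (by linarith)
  · have hk0 : (0 : ℝ) ≤ k := Nat.cast_nonneg k
    have hs0 : 0 ≤ step k := by
      rw [hstep]
      exact div_nonneg (by linarith) (by linarith)
    have hs1 : step k ≤ 1 := by
      rw [hstep, div_le_one (by linarith)]
      linarith
    refine (hT.integral_averagedNoise_sq_succ_le hk hs0 hs1 (fun s a b t x =>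
      (abs_martingaleNoise_le hφΦ (hK s a k hk) _ _ _ _).trans
        (mul_le_mul_of_nonneg_left (one_add_two_mul_log_le hk) (by positivity))) x).trans_eq ?_
    simp only [hstep]
    ring

theorem IsTrajectory.integral_spanSeminorm_averagedNoise_sq_le
    (hT : M.IsTrajectory π s₁ ℙ St Ac)
    (hα : 2 ≤ α) (hαh : α ≤ h) (hΦ : 0 ≤ Φ) (hφΦ : ∀ t s, |φ t s| ≤ Φ)
    (hstep : step = fun j : ℕ => α / ((j : ℝ) + h))
    (hK : ∀ s a (k : ℕ), 1 ≤ k → ∀ x, |M.qLearning step Q₁ s a k x| ≤ K * Real.log ((k : ℝ) + 1))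
    {k : ℕ} (hk : 1 ≤ k) :
    ∫ ω, spanSeminorm (M.averagedNoise π φ step Q₁ (fun i => St i ω) (fun i => Ac i ω) k) ^ 2 ∂ℙ
      ≤ Fintype.card (S × A) * (((2 + 2 * Φ) * (1 / Real.log 2 + 2 * K)) ^ 2 * α ^ 2
        * Real.log ((k : ℝ) + 1) ^ 2 / (k + h)) := by
  have hdep := dependsOnPast_averagedNoise M π φ step Q₁ hk
  have hint : ∀ x ∈ Finset.univ, Integrable (fun ω =>
      M.averagedNoise π φ step Q₁ (fun i => St i ω) (fun i => Ac i ω) k x ^ 2) ℙ :=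
    fun x _ => hT.integrable (hdep.comp fun f => f x ^ 2)
  calc _ ≤ ∫ ω, ∑ x, M.averagedNoise π φ step Q₁ (fun i => St i ω) (fun i => Ac i ω) k x ^ 2 ∂ℙ :=
        integral_mono (hT.integrable (hdep.comp fun f => spanSeminorm f ^ 2))
          (integrable_finsetSum _ hint) fun ω => spanSeminorm_sq_le_sum_sq _
    _ = ∑ x, ∫ ω, M.averagedNoise π φ step Q₁ (fun i => St i ω) (fun i => Ac i ω) k x ^ 2 ∂ℙ :=
        integral_finsetSum _ hint
    _ ≤ ∑ _x : S × A, (((2 + 2 * Φ) * (1 / Real.log 2 + 2 * K)) ^ 2 * α ^ 2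
        * Real.log ((k : ℝ) + 1) ^ 2 / (k + h)) :=
        Finset.sum_le_sum fun x _ =>
          hT.integral_averagedNoise_sq_le hα hαh hΦ hφΦ hstep hK hk x
    _ = _ := by rw [Finset.sum_const, Finset.card_univ, nsmul_eq_mul]

end MeanSquare

end FiniteMDP

theorem tendsto_log_succ_sq_div :
    Tendsto (fun k : ℕ => Real.log ((k : ℝ) + 1) ^ 2 / (k : ℝ)) atTop (𝓝 0) := by
  have h1 : Tendsto (fun k : ℕ => Real.log ((k : ℝ) + 1) ^ 2 / ((k : ℝ) + 1)) atTop (𝓝 0) :=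
    (Real.isLittleO_pow_log_id_atTop (n := 2)).tendsto_div_nhds_zero.comp
      (tendsto_atTop_add_const_right _ _ tendsto_natCast_atTop_atTop)
  have h2 := h1.const_mul 2
  rw [mul_zero] at h2
  refine tendsto_of_tendsto_of_tendsto_of_le_of_le' tendsto_const_nhds h2
    (Eventually.of_forall fun k => by positivity) ?_
  filter_upwards [eventually_ge_atTop 1] with k hk
  have hk1 : (1 : ℝ) ≤ k := by exact_mod_cast hk
  rw [← mul_div_assoc, div_le_div_iff₀ (by linarith) (by linarith)]
  nlinarith [sq_nonneg (Real.log ((k : ℝ) + 1))]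

namespace FiniteMDP

variable {S A : Type*} [Fintype S] [DecidableEq S] [Nonempty S] [Fintype A] [DecidableEq A]
  [Nonempty A] {M : FiniteMDP S A} {π : Policy S A} {μ : S → ℝ} {φ : S → S → ℝ}
  {Q₁ Qbar : S × A → ℝ} {α h Φ K : ℝ} {step : ℕ → ℝ} {s₁ : S}

section MeanSquare

variable {Ω : Type*} [MeasurableSpace Ω] {ℙ : Measure Ω} [IsProbabilityMeasure ℙ]
  {St : ℕ → Ω → S} {Ac : ℕ → Ω → A}

/-- The constant `C` collects the inputs of the squared recursion: the noise moment contributes `α ^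
2 / (k + h) = α * step k`, hence the single factor `α`, and the boundary terms lose one power of the
stepsize through `step k ≤ 1`. `C'` is left free above `C * α ^ 2` so that it can also cover the
initial error. -/
theorem IsTrajectory.integral_spanSeminorm_correctedError_sq_le
    (hT : M.IsTrajectory π s₁ ℙ St Ac)
    (hφ : ∀ t s, φ t s - (M.stateMatrix π *ᵥ φ t) s = (if s = t then 1 else 0) - μ t)
    {b : ℝ} (hb0 : 0 ≤ b) (hb1 : b < 1) (hb : ∀ Q₁ Q₂ : S × A → ℝ,
      spanSeminorm (M.asyncBellman π μ Q₁ - M.asyncBellman π μ Q₂) ≤ b * spanSeminorm (Q₁ - Q₂))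
    (hQbar : spanSeminorm (M.asyncBellman π μ Qbar - Qbar) = 0)
    (hα : 2 ≤ (1 - b) * α) (hαh : α ≤ h) (hΦ : 0 ≤ Φ) (hφΦ : ∀ t s, |φ t s| ≤ Φ)
    (hstep : step = fun j : ℕ => α / ((j : ℝ) + h)) (hK0 : 0 ≤ K)
    (hK : ∀ s a (k : ℕ), 1 ≤ k → ∀ x, |M.qLearning step Q₁ s a k x| ≤ K * Real.log ((k : ℝ) + 1))
    {C C' : ℝ} (hC : C = 2 / (1 - b) * (Fintype.card (S × A)
      * (((2 + 2 * Φ) * (1 / Real.log 2 + 2 * K)) ^ 2 * α)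
        + (6 * Φ * (1 / Real.log 2 + 2 * K)) ^ 2)) (hC' : C * α ^ 2 ≤ C')
    (h1 : ∀ s a, spanSeminorm (M.correctedError π φ step Q₁ Qbar s a 1) ^ 2
      ≤ C' * Real.log 2 ^ 2 / (1 + h))
    {k : ℕ} (hk : 1 ≤ k) :
    ∫ ω, spanSeminorm (M.correctedError π φ step Q₁ Qbar (fun i => St i ω) (fun i => Ac i ω) k) ^ 2
      ∂ℙ ≤ C' * Real.log ((k : ℝ) + 1) ^ 2 / (k + h) := by
  have hc : 0 < 1 - b := by linarith
  have hα2 : 2 ≤ α := by nlinarith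
  have hlog2 : 0 < Real.log 2 := Real.log_pos one_lt_two
  have hC0 : 0 ≤ C := by rw [hC]; positivity
  refine le_div_of_stepsize_recursion (c := 1 - b) (C := C)
    (A := fun k => ∫ ω, spanSeminorm
      (M.correctedError π φ step Q₁ Qbar (fun i => St i ω) (fun i => Ac i ω) k) ^ 2 ∂ℙ)
    (Λ := fun k => Real.log ((k : ℝ) + 1) ^ 2) (fun k _ => sq_nonneg _) (fun k hk => ?_)
    (by linarith) hα (by nlinarith) hC' (le_trans (by positivity) hC') ?_ (fun k hk => ?_) hk
  · gcongr
    · exact (log_succ_pos hk).le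
    · exact k.le_succ
  · have hdep := dependsOnPast_correctedError M π φ step Q₁ Qbar le_rfl
    simp only [Nat.cast_one, one_add_one_eq_two]
    calc _ ≤ ∫ _ω, C' * Real.log 2 ^ 2 / (1 + h) ∂ℙ :=
          integral_mono (hT.integrable (hdep.comp fun f => spanSeminorm f ^ 2))
            (integrable_const _) fun ω => h1 _ _
      _ = _ := by simp
  · have hk0 : (0 : ℝ) ≤ k := Nat.cast_nonneg k
    have hkh : 0 < (k : ℝ) + h := by linarith
    have hs0 : 0 ≤ step k := by
      rw [hstep]
      exact div_nonneg (by linarith) hkh.le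
    have hs1 : step k ≤ 1 := by
      rw [hstep, div_le_one hkh]
      linarith
    have hq := hT.integrable
      ((dependsOnPast_correctedError M π φ step Q₁ Qbar hk).comp fun f => spanSeminorm f ^ 2)
    have hv := hT.integrable
      ((dependsOnPast_averagedNoise M π φ step Q₁ hk).comp fun f => spanSeminorm f ^ 2)
    have hvE : Integrable (fun ω => spanSeminorm (M.averagedNoise π φ step Q₁
        (fun i => St i ω) (fun i => Ac i ω) k) ^ 2
        + (6 * Φ * (1 / Real.log 2 + 2 * K) * step k * Real.log ((k : ℝ) + 1)) ^ 2) ℙ :=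
      hv.add (integrable_const _)
    have hEv := hT.integral_spanSeminorm_averagedNoise_sq_le hα2 hαh hΦ hφΦ hstep hK hk
    calc _ ≤ ∫ ω, ((1 - (1 - b) * step k) * spanSeminorm (M.correctedError π φ step Q₁ Qbar
            (fun i => St i ω) (fun i => Ac i ω) k) ^ 2
          + 2 / (1 - b) * step k * (spanSeminorm (M.averagedNoise π φ step Q₁
            (fun i => St i ω) (fun i => Ac i ω) k) ^ 2
          + (6 * Φ * (1 / Real.log 2 + 2 * K) * step k * Real.log ((k : ℝ) + 1)) ^ 2)) ∂ℙ :=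
          integral_mono (hT.integrable ((dependsOnPast_correctedError M π φ step Q₁ Qbar
            (Nat.le_add_left 1 k)).comp fun f => spanSeminorm f ^ 2))
            ((hq.const_mul _).add (hvE.const_mul _)) fun ω =>
            spanSeminorm_correctedError_succ_sq_le hφ hb0 hb1 hb hQbar (by linarith) hαh hΦ hK0
              hφΦ hstep (hK _ _) hk
      _ = (1 - (1 - b) * step k) * ∫ ω, spanSeminorm (M.correctedError π φ step Q₁ Qbar
            (fun i => St i ω) (fun i => Ac i ω) k) ^ 2 ∂ℙ
          + 2 / (1 - b) * step k * (∫ ω, spanSeminorm (M.averagedNoise π φ step Q₁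
            (fun i => St i ω) (fun i => Ac i ω) k) ^ 2 ∂ℙ
          + (6 * Φ * (1 / Real.log 2 + 2 * K) * step k * Real.log ((k : ℝ) + 1)) ^ 2) := by
          rw [integral_add (hq.const_mul _) (hvE.const_mul _), integral_const_mul,
            integral_const_mul]
          rw [integral_add hv (integrable_const _)]
          simp
      _ ≤ (1 - (1 - b) * step k) * ∫ ω, spanSeminorm (M.correctedError π φ step Q₁ Qbar
            (fun i => St i ω) (fun i => Ac i ω) k) ^ 2 ∂ℙ
          + 2 / (1 - b) * step k * (Fintype.card (S × A)
            * (((2 + 2 * Φ) * (1 / Real.log 2 + 2 * K)) ^ 2 * α ^ 2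
            * Real.log ((k : ℝ) + 1) ^ 2 / (k + h))
          + (6 * Φ * (1 / Real.log 2 + 2 * K)) ^ 2 * step k * Real.log ((k : ℝ) + 1) ^ 2) := by
          refine add_le_add le_rfl
            (mul_le_mul_of_nonneg_left (add_le_add hEv ?_) (by positivity))
          rw [mul_pow, mul_pow]
          gcongr
          nlinarith
      _ = _ := by
          rw [hC]
          simp only [hstep]
          ring

theorem IsTrajectory.integral_spanSeminorm_qLearning_sub_sq_le
    (hT : M.IsTrajectory π s₁ ℙ St Ac) (hα : 2 ≤ α) (hαh : α ≤ h) (hΦ : 0 ≤ Φ)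
    (hφΦ : ∀ t s, |φ t s| ≤ Φ) (hstep : step = fun j : ℕ => α / ((j : ℝ) + h))
    (hK : ∀ s a (k : ℕ), 1 ≤ k → ∀ x, |M.qLearning step Q₁ s a k x| ≤ K * Real.log ((k : ℝ) + 1))
    {C V : ℝ} (hC0 : 0 ≤ C) (hV0 : 0 ≤ V) {k : ℕ} (hk : 1 ≤ k)
    (hq : ∫ ω, spanSeminorm (M.correctedError π φ step Q₁ Qbar (fun i => St i ω)
      (fun i => Ac i ω) k) ^ 2 ∂ℙ ≤ C * Real.log ((k : ℝ) + 1) ^ 2 / (k + h))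
    (hv : ∫ ω, spanSeminorm (M.averagedNoise π φ step Q₁ (fun i => St i ω)
      (fun i => Ac i ω) k) ^ 2 ∂ℙ ≤ V * Real.log ((k : ℝ) + 1) ^ 2 / (k + h)) :
    ∫ ω, spanSeminorm (M.qLearning step Q₁ (fun i => St i ω) (fun i => Ac i ω) k - Qbar) ^ 2 ∂ℙ
      ≤ 3 * (C + V + (Φ * (1 / Real.log 2 + 2 * K) * α) ^ 2) * Real.log ((k : ℝ) + 1) ^ 2 / k := by
  have hk1 : (1 : ℝ) ≤ k := by exact_mod_cast hk
  have hkh : 1 ≤ (k : ℝ) + h := by linarith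
  have hs0 : 0 ≤ step k := by
    rw [hstep]
    exact div_nonneg (by linarith) (by linarith)
  set E := Φ * (1 / Real.log 2 + 2 * K) * step k * Real.log ((k : ℝ) + 1) with hE
  have hqi := hT.integrable
    ((dependsOnPast_correctedError M π φ step Q₁ Qbar hk).comp fun f => spanSeminorm f ^ 2)
  have hvi := hT.integrable
    ((dependsOnPast_averagedNoise M π φ step Q₁ hk).comp fun f => spanSeminorm f ^ 2)
  have hqv := hqi.add hvi
  have hE2 : E ^ 2 ≤ (Φ * (1 / Real.log 2 + 2 * K) * α) ^ 2 * Real.log ((k : ℝ) + 1) ^ 2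
      / (k + h) := by
    have h1 : E ^ 2 = (Φ * (1 / Real.log 2 + 2 * K) * α) ^ 2 * Real.log ((k : ℝ) + 1) ^ 2
        / (k + h) ^ 2 := by
      rw [hE]
      simp only [hstep]
      field_simp
    rw [h1]
    gcongr
    nlinarith
  calc _ ≤ ∫ ω, 3 * (spanSeminorm (M.correctedError π φ step Q₁ Qbar (fun i => St i ω)
        (fun i => Ac i ω) k) ^ 2 + spanSeminorm (M.averagedNoise π φ step Q₁ (fun i => St i ω)
        (fun i => Ac i ω) k) ^ 2 + E ^ 2) ∂ℙ := by
        refine integral_mono (hT.integrable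
          ((dependsOnPast_qLearning M step Q₁ hk).comp fun f => spanSeminorm (f - Qbar) ^ 2))
          ((hqv.add (integrable_const _)).const_mul _) fun ω => ?_
        have h1 := spanSeminorm_qLearning_sub_le (M := M) (π := π) (Qbar := Qbar) hΦ hφΦ
          (hK (fun i => St i ω) fun i => Ac i ω) hs0 hk
        have h2 := pow_le_pow_left₀ (spanSeminorm_nonneg _) h1 2
        simp only at h2 ⊢
        set p := spanSeminorm (M.correctedError π φ step Q₁ Qbar (fun i => St i ω)
          (fun i => Ac i ω) k)
        set v := spanSeminorm (M.averagedNoise π φ step Q₁ (fun i => St i ω) (fun i => Ac i ω) k)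
        refine h2.trans ?_
        nlinarith [sq_nonneg (p - v), sq_nonneg (p - E), sq_nonneg (v - E)]
    _ = 3 * (∫ ω, spanSeminorm (M.correctedError π φ step Q₁ Qbar (fun i => St i ω)
        (fun i => Ac i ω) k) ^ 2 ∂ℙ + ∫ ω, spanSeminorm (M.averagedNoise π φ step Q₁
        (fun i => St i ω) (fun i => Ac i ω) k) ^ 2 ∂ℙ + E ^ 2) := by
        rw [integral_const_mul, ← integral_add hqi hvi]
        congr 1
        exact (integral_add hqv (integrable_const _)).trans (by simp)
    _ ≤ 3 * (C * Real.log ((k : ℝ) + 1) ^ 2 / (k + h) + V * Real.log ((k : ℝ) + 1) ^ 2 / (k + h)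
        + (Φ * (1 / Real.log 2 + 2 * K) * α) ^ 2 * Real.log ((k : ℝ) + 1) ^ 2 / (k + h)) := by
        gcongr
    _ = 3 * (C + V + (Φ * (1 / Real.log 2 + 2 * K) * α) ^ 2) * Real.log ((k : ℝ) + 1) ^ 2
        / (k + h) := by ring
    _ ≤ _ := by
        gcongr
        linarith

end MeanSquare

/-- The mean-square rate of `Q`-learning with universal stepsizes. -/
theorem exists_integral_spanSeminorm_sq_le {b : ℝ} (hπ : M.ErgodicPolicy π)
    (hμ : M.IsStationary π μ) (hb0 : 0 ≤ b) (hb1 : b < 1) (hb : ∀ Q₁ Q₂ : S × A → ℝ,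
      spanSeminorm (M.asyncBellman π μ Q₁ - M.asyncBellman π μ Q₂) ≤ b * spanSeminorm (Q₁ - Q₂))
    (hQbar : spanSeminorm (M.asyncBellman π μ Qbar - Qbar) = 0)
    (hα : 2 ≤ (1 - b) * α) (hαh : α ≤ h) (Q₁ : S × A → ℝ) :
    ∃ C : ℝ, ∀ (s₁ : S) (Ω : Type*) [MeasurableSpace Ω] (ℙ : Measure Ω) [IsProbabilityMeasure ℙ]
      (St : ℕ → Ω → S) (Ac : ℕ → Ω → A), M.IsTrajectory π s₁ ℙ St Ac → ∀ k : ℕ, 1 ≤ k →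
      ∫ ω, spanSeminorm (M.qLearning (fun j => α / ((j : ℝ) + h)) Q₁
        (fun i => St i ω) (fun i => Ac i ω) k - Qbar) ^ 2 ∂ℙ
        ≤ C * Real.log ((k : ℝ) + 1) ^ 2 / (k : ℝ) := by
  have hα2 : 2 ≤ α := by nlinarith
  have hlog2 : 0 < Real.log 2 := Real.log_pos one_lt_two
  have hpoisson : ∀ t, ∃ f : S → ℝ, ∀ s,
      f s - (M.stateMatrix π *ᵥ f) s = (if s = t then 1 else 0) - μ t := fun t => by
    refine exists_poisson_solution (M.stateMatrix_mem_rowStochastic π) hπ.irreducible hμ.1 hμ.2 ?_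
    simp [dotProduct, mul_sub, ← Finset.sum_mul, hμ.1.2]
  choose φ hφ using hpoisson
  obtain ⟨Φ, hΦ⟩ : ∃ Φ : ℝ, ∀ t s, |φ t s| ≤ Φ :=
    ⟨‖φ‖, fun t s => (norm_le_pi_norm (φ t) s).trans (norm_le_pi_norm φ t)⟩
  have hΦ0 : 0 ≤ Φ := (abs_nonneg _).trans
    (hΦ (Classical.arbitrary S) (Classical.arbitrary S))
  set step : ℕ → ℝ := fun j => α / ((j : ℝ) + h) with hstep
  set K := α + ‖Q₁‖ / Real.log 2 with hKdef
  have hK0 : 0 ≤ K := by positivity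
  have hK : ∀ s a (k : ℕ), 1 ≤ k → ∀ x,
      |M.qLearning step Q₁ s a k x| ≤ K * Real.log ((k : ℝ) + 1) := fun s a k hk =>
    abs_qLearning_le (by linarith) hαh (by linarith) (norm_nonneg _)
      (fun x => norm_le_pi_norm Q₁ x) hk
  set B := spanSeminorm (Q₁ - Qbar) + Φ * (1 / Real.log 2 + 2 * K) * step 1 * Real.log 2
  have hs1 : 0 ≤ step 1 := by
    rw [hstep]
    exact div_nonneg (by linarith) (by push_cast; linarith)
  have hB : ∀ s a, spanSeminorm (M.correctedError π φ step Q₁ Qbar s a 1) ≤ B := by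
    intro s a
    have h1 := spanSeminorm_smul_correction_le (M := M) (π := π) hΦ0 hΦ (hK s a) hs1 le_rfl
    rw [Nat.cast_one, one_add_one_eq_two] at h1
    refine le_trans (le_of_eq (congrArg _ ?_)) ((spanSeminorm_add_le _ _).trans
      (add_le_add le_rfl h1))
    ext x
    simp [correctedError, averagedNoise, qLearning]
  set C := 2 / (1 - b) * (Fintype.card (S × A)
      * (((2 + 2 * Φ) * (1 / Real.log 2 + 2 * K)) ^ 2 * α)
        + (6 * Φ * (1 / Real.log 2 + 2 * K)) ^ 2) with hC
  have hc : 0 < 1 - b := by linarith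
  have hC0 : 0 ≤ C := by positivity
  have hh : 0 < 1 + h := by linarith
  -- The first summand serves the recursion, the second the initial value, uniformly over paths.
  set C' := C * α ^ 2 + B ^ 2 * (1 + h) / Real.log 2 ^ 2 with hC'
  refine ⟨_, fun s₁ Ω _ ℙ _ St Ac hT k hk =>
    hT.integral_spanSeminorm_qLearning_sub_sq_le (C := C') (V := Fintype.card (S × A)
      * (((2 + 2 * Φ) * (1 / Real.log 2 + 2 * K)) ^ 2 * α ^ 2)) hα2 hαh hΦ0 hΦ hstep hK
      (by positivity) (by positivity) hk ?_ ?_⟩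
  · refine hT.integral_spanSeminorm_correctedError_sq_le hφ hb0 hb1 hb hQbar hα hαh hΦ0 hΦ hstep
      hK0 hK hC (le_add_of_nonneg_right (by positivity)) (fun s a => ?_) hk
    calc _ ≤ B ^ 2 := pow_le_pow_left₀ (spanSeminorm_nonneg _) (hB s a) 2
      _ = B ^ 2 * (1 + h) / Real.log 2 ^ 2 * Real.log 2 ^ 2 / (1 + h) := by field_simp
      _ ≤ _ := by
          gcongr
          exact le_add_of_nonneg_left (by positivity)
  · refine (hT.integral_spanSeminorm_averagedNoise_sq_le hα2 hαh hΦ0 hΦ hstep hK hk).trans_eq ?_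
    ring

/-- Mean-square limits in the span seminorm are unique modulo constants. -/
theorem spanSeminorm_sub_eq_zero_of_tendsto {ι Ω : Type*} [Fintype ι] [Nonempty ι]
    [MeasurableSpace Ω] {ℙ : Measure Ω} [IsProbabilityMeasure ℙ] {X : ℕ → Ω → ι → ℝ}
    {x y : ι → ℝ} (hx : ∀ᶠ k in atTop, Integrable (fun ω => spanSeminorm (X k ω - x) ^ 2) ℙ)
    (hy : ∀ᶠ k in atTop, Integrable (fun ω => spanSeminorm (X k ω - y) ^ 2) ℙ)
    (hxt : Tendsto (fun k => ∫ ω, spanSeminorm (X k ω - x) ^ 2 ∂ℙ) atTop (𝓝 0))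
    (hyt : Tendsto (fun k => ∫ ω, spanSeminorm (X k ω - y) ^ 2 ∂ℙ) atTop (𝓝 0)) :
    spanSeminorm (x - y) = 0 := by
  have hlim := (hxt.add hyt).const_mul 2
  rw [add_zero, mul_zero] at hlim
  have hle : spanSeminorm (x - y) ^ 2 ≤ 0 := by
    refine ge_of_tendsto hlim ?_
    filter_upwards [hx, hy] with k hxk hyk
    rw [← integral_add hxk hyk, ← integral_const_mul]
    calc spanSeminorm (x - y) ^ 2 = ∫ _ω, spanSeminorm (x - y) ^ 2 ∂ℙ := by simp
      _ ≤ _ := by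
        refine integral_mono (integrable_const _) ((hxk.add hyk).const_mul 2) fun ω => ?_
        have h1 := spanSeminorm_sub_le (X k ω - y) (X k ω - x)
        rw [sub_sub_sub_cancel_left] at h1
        refine (pow_le_pow_left₀ (spanSeminorm_nonneg _) h1 2).trans (add_sq_le.trans_eq ?_)
        ring
  exact pow_eq_zero_iff two_ne_zero |>.1 (le_antisymm hle (sq_nonneg _))

end FiniteMDP

end

/-! ### Assembly of the four claims -/

theorem mainTheorem4 {S A : Type*} [Fintype S] [DecidableEq S] [Nonempty S]
    [Fintype A] [DecidableEq A] [Nonempty A]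
    (M : FiniteMDP S A) (π : Policy S A) (μ : S → ℝ)
    (hM : M.SpanContraction) (hπ : M.ErgodicPolicy π) (hμ : M.IsStationary π μ) :
    -- the degenerate case: same solutions
    (FiniteMDP.visitMatrix π μ
        = (1 / ((Fintype.card S : ℝ) * (Fintype.card A : ℝ))) • (1 : Matrix (S × A) (S × A) ℝ) →
      {Q : S × A → ℝ | spanSeminorm (M.asyncBellman π μ Q - Q) = 0}
        = {Q : S × A → ℝ | spanSeminorm (M.bellman Q - Q) = 0}) ∧
    -- all other cases, for a nonzero optimal average reward: no common solution
    (FiniteMDP.visitMatrix π μ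
        ≠ (1 / ((Fintype.card S : ℝ) * (Fintype.card A : ℝ))) • (1 : Matrix (S × A) (S × A) ℝ) →
      M.optimalAverageReward ≠ 0 →
      {Q : S × A → ℝ | spanSeminorm (M.asyncBellman π μ Q - Q) = 0}
        ∩ {Q : S × A → ℝ | spanSeminorm (M.bellman Q - Q) = 0} = ∅) ∧
    -- mean-square convergence to a solution of the asynchronous equation
    ∃ Qbar : S × A → ℝ, spanSeminorm (M.asyncBellman π μ Qbar - Qbar) = 0 ∧
      ∃ α₀ : ℝ, 0 < α₀ ∧ ∀ α : ℝ, α₀ ≤ α → ∃ h₀ : ℝ, 0 < h₀ ∧ ∀ h : ℝ, h₀ ≤ h →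
        ∃ m : ℕ, ∀ Q₁ : S × A → ℝ, ∃ C : ℝ,
          ∀ (s₁ : S) (Ω : Type*) [MeasurableSpace Ω] (ℙ : Measure Ω) [IsProbabilityMeasure ℙ]
            (St : ℕ → Ω → S) (Ac : ℕ → Ω → A), M.IsTrajectory π s₁ ℙ St Ac →
            -- the rate `Õ(1/k)`
            (∀ k : ℕ, 1 ≤ k →
              Integrable (fun ω => spanSeminorm (M.qLearning (fun j => α / ((j : ℝ) + h)) Q₁
                (fun i => St i ω) (fun i => Ac i ω) k - Qbar) ^ 2) ℙ ∧
              ∫ ω, spanSeminorm (M.qLearning (fun j => α / ((j : ℝ) + h)) Q₁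
                (fun i => St i ω) (fun i => Ac i ω) k - Qbar) ^ 2 ∂ℙ
                ≤ C * Real.log ((k : ℝ) + 1) ^ m / (k : ℝ)) ∧
            -- the target is wrong: no convergence to a solution of the original equation
            (FiniteMDP.visitMatrix π μ
                ≠ (1 / ((Fintype.card S : ℝ) * (Fintype.card A : ℝ)))
                  • (1 : Matrix (S × A) (S × A) ℝ) →
              M.optimalAverageReward ≠ 0 →
              ∀ Q : S × A → ℝ, spanSeminorm (M.bellman Q - Q) = 0 →
                ¬ Tendsto (fun k : ℕ =>
                  ∫ ω, spanSeminorm (M.qLearning (fun j => α / ((j : ℝ) + h)) Q₁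
                    (fun i => St i ω) (fun i => Ac i ω) k - Q) ^ 2 ∂ℙ) atTop (𝓝 0)) := by
  refine ⟨FiniteMDP.setOf_asyncBellman_eq_of_uniform,
    FiniteMDP.setOf_asyncBellman_inter_eq_empty hμ, ?_⟩
  obtain ⟨b, hb0, hb1, hb⟩ := FiniteMDP.asyncBellman_spanContraction hM hπ hμ
  obtain ⟨Qbar, hQbar⟩ := exists_spanSeminorm_map_sub_eq_zero hb0 hb1 hb
  have hc : 0 < 1 - b := by linarith
  -- This threshold is the condition `2 ≤ (1 - b) * α` of the scalar recursion. Below, `h₀ = α`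
  -- keeps the stepsizes at most one, and `m = 2` comes from squaring the logarithmic growth.
  refine ⟨Qbar, hQbar, 2 / (1 - b), by positivity, fun α hα => ?_⟩
  rw [div_le_iff₀' hc] at hα
  have hα2 : 2 ≤ α := by nlinarith
  refine ⟨α, by linarith, fun h hh => ⟨2, fun Q₁ => ?_⟩⟩
  obtain ⟨C, hC⟩ := FiniteMDP.exists_integral_spanSeminorm_sq_le hπ hμ hb0 hb1 hb hQbar hα hh Q₁
  refine ⟨C, fun s₁ Ω _ ℙ _ St Ac hT => ?_⟩
  have hint : ∀ (Q : S × A → ℝ) (k : ℕ), 1 ≤ k →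
      Integrable (fun ω => spanSeminorm (M.qLearning (fun j => α / ((j : ℝ) + h)) Q₁
        (fun i => St i ω) (fun i => Ac i ω) k - Q) ^ 2) ℙ := fun Q k hk =>
    hT.integrable ((FiniteMDP.dependsOnPast_qLearning M _ Q₁ hk).comp
      fun f => spanSeminorm (f - Q) ^ 2)
  have hrate := hC s₁ Ω ℙ St Ac hT
  refine ⟨fun k hk => ⟨hint Qbar k hk, hrate k hk⟩, fun hD hr Q hQ hlim => ?_⟩
  have hlim' : Tendsto (fun k : ℕ => ∫ ω, spanSeminorm (M.qLearning
      (fun j => α / ((j : ℝ) + h)) Q₁ (fun i => St i ω) (fun i => Ac i ω) k - Qbar) ^ 2 ∂ℙ)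
      atTop (𝓝 0) := by
    have h0 := tendsto_log_succ_sq_div.const_mul C
    rw [mul_zero] at h0
    refine tendsto_of_tendsto_of_tendsto_of_le_of_le' tendsto_const_nhds h0
      (Eventually.of_forall fun k => integral_nonneg fun ω => sq_nonneg _) ?_
    filter_upwards [eventually_ge_atTop 1] with k hk
    rw [← mul_div_assoc]
    exact hrate k hk
  have hev : ∀ Q : S × A → ℝ, ∀ᶠ k in atTop, Integrable (fun ω => spanSeminorm
      (M.qLearning (fun j => α / ((j : ℝ) + h)) Q₁ (fun i => St i ω) (fun i => Ac i ω) k - Q) ^ 2)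
      ℙ := fun Q => (eventually_ge_atTop 1).mono (hint Q)
  have hsub := FiniteMDP.spanSeminorm_sub_eq_zero_of_tendsto (hev Q) (hev Qbar) hlim hlim'
  have hmem : Q ∈ {Q : S × A → ℝ | spanSeminorm (M.asyncBellman π μ Q - Q) = 0}
      ∩ {Q : S × A → ℝ | spanSeminorm (M.bellman Q - Q) = 0} :=
    ⟨FiniteMDP.spanSeminorm_asyncBellman_congr hsub hQbar, hQ⟩
  rw [FiniteMDP.setOf_asyncBellman_inter_eq_empty hμ hD hr] at hmem
  exact hmem
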